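/- **Setting.** Let $(X,d)$ be a locally compact, separable, complete metric space with at least two points, and let $m$ be a Radon measure on $X$ with full support. Let $B(x,r)=\{y: d(x,y)<r\}$, $\partial\Omega$ the topological boundary, $u_B=\frac1{m(B)}\int_B u\,dm$, and $C_c(X)$ the compactly supported continuous real functions. Let $p\in(1,\infty)$, let $\mathcal F_p$ be a linear subspace of $L^p(X,m)$, $\mathcal E_p:\mathcal F_p\to[0,\infty)$ a functional such that $\mathcal E_p^{1/p}$ is a seminorm, and $\{\Gamma_p\langle u\rangle\}_{u\in\mathcal F_p}$ a family of finite Borel measures on $X$, such that: 1. if $u\in\mathcal F_p$ and $\varphi:\mathbb R\to\mathbb R$ is $1$-Lipschitz with $\varphi(0)=0$, then $\varphi(u)\in\mathcal F_p$ and $\mathcal E_p(\varphi(u))\le\mathcal E_p(u)$; and $\mathcal E_p(u)=0$ implies that $u$ is $m$-a.e. constant; 2. $\mathcal F_p$ with the norm $\|u\|_{L^p}+\mathcal E_p(u)^{1/p}$ is a reflexive Banach space; 3. $\mathcal F_p\cap C_c(X)$ is dense in $\mathcal F_p$, and dense in $C_c(X)$ with respect to the uniform norm; 4. for every Borel set $A$,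 $u\mapsto\Gamma_p\langle u\rangle(A)^{1/p}$ is a seminorm on $\mathcal F_p$; 5. $\mathcal E_p(u)=\Gamma_p\langle u\rangle(X)$ for $u\in\mathcal F_p$; 6. if $u,v\in\mathcal F_p\cap C_c(X)$ and $u-v$ is constant on an open set $U$, then $\Gamma_p\langle u\rangle|_U=\Gamma_p\langle v\rangle|_U$. Let $\Psi:(0,\infty)\to(0,\infty)$ be a continuous increasing bijection for which there are $C_\Psi\ge1$ and $\beta_1,\beta_2>0$ with $C_\Psi^{-1}(R/r)^{\beta_1}\le\Psi(R)/\Psi(r)\le C_\Psi(R/r)^{\beta_2}$ for all $0<r\le R$. **Local spaces.** For an open set $U\subset X$, $\mathcal F_{p,\mathrm{loc}}(U)$ is the set of ($m$-classes of) measurable $u:U\to\mathbb R$ such that for each relatively compact open subset $A$ of $U$ there is $u^\#\in\mathcal F_p$ with $u=u^\#$ $m$-a.e. on $A$. For such $u$, the measure $\Gamma_p\langle u\rangle$ on $U$ is the one that coincides on each such $A$ with $\Gamma_p\langle u^\#\rangle$ (for $E\subset U$ Borel, $\Gamma_p\langle u\rangle(E)$ is the limit of $\Gamma_p\langle u\rangle(E\cap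 A_n)$ along an exhaustion $(A_n)$ of $U$ by relatively compact open subsets of $U$). Put $\mathcal F_p(U)=\{u\in\mathcal F_{p,\mathrm{loc}}(U):\int_U|u|^p\,dm+\Gamma_p\langle u\rangle(U)<\infty\}$. An open set $\Omega\ne X$ has property (E) if every $f\in\mathcal F_p(\Omega)$ admits $F\in\mathcal F_p$ with $f=F$ $m$-a.e. on $\Omega$ and $\Gamma_p\langle F\rangle(\partial\Omega)=0$. **Hypotheses.** * (VD): there is $c_{\mathrm D}\ge1$ with $m(B(x,2r))\le c_{\mathrm D}\,m(B(x,r))$ for all $x\in X$, $r>0$. * PI$_p(\Psi)$: there are $C_{\mathrm P}>0$ and $A_{\mathrm P}\ge1$ with $\int_{B(x,r)}|u-u_{B(x,r)}|^p\,dm\le C_{\mathrm P}\Psi(r)\,\Gamma_p\langle u\rangle(B(x,A_{\mathrm P}r))$ for all $x\in X$, $r>0$, $u\in\mathcal F_p$. * cap$_p(\Psi)_\le$: there are $C_{\mathrm{cap}},A_1,A_2>1$ such that for all $x\in X$ and $0<R<\operatorname{diam}(X)/A_2$, $$\inf\{\mathcal E_p(u): u\in\mathcal F_p,\ u=1\text{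 a.e. on }B(x,R),\ u=0\text{ a.e. on }X\setminus B(x,A_1R)\}\le C_{\mathrm{cap}}\frac{m(B(x,R))}{\Psi(R)}\qquad(\inf\emptyset=\infty).$$ **Statement (Korevaar–Schoen type characterization).** Assume (VD), PI$_p(\Psi)$ and cap$_p(\Psi)_\le$. Then there exists $C\in[1,\infty)$ such that for every open $\Omega\subset X$ with property (E) and every $u\in\mathcal F_p(\Omega)$, $$C^{-1}\Gamma_p\langle u\rangle(\Omega)\le\liminf_{r\downarrow0}\int_\Omega\frac1{m(B(y,r))}\int_{\Omega\cap B(y,r)}\frac{|u(x)-u(y)|^p}{\Psi(r)}\,m(dx)\,m(dy)$$ $$\le\limsup_{r\downarrow0}\int_\Omega\frac1{m(B(y,r))}\int_{\Omega\cap B(y,r)}\frac{|u(x)-u(y)|^p}{\Psi(d(x,y))}\,m(dx)\,m(dy)\le C\,\Gamma_p\langle u\rangle(\Omega),$$ and, moreover, for every $u\in\mathcal F_p$, $$C^{-1}\mathcal E_p(u)\le\liminf_{r\downarrow0}\int_X\frac1{m(B(y,r))}\int_{B(y,r)}\frac{|u(x)-u(y)|^p}{\Psi(r)}\,m(dx)\,m(dy)$$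 $$\le\sup_{r>0}\int_X\frac1{m(B(y,r))}\int_{B(y,r)}\frac{|u(x)-u(y)|^p}{\Psi(d(x,y))}\,m(dx)\,m(dy)\le C\,\mathcal E_p(u),$$ where the integrand $|u(x)-u(y)|^p/\Psi(d(x,y))$ is read as $0$ for $x=y$. -/

import Mathlib

open MeasureTheory Set Filter Topology
open scoped ENNReal CompactlySupported

noncomputable section

instance factOneLeOfReal (p : ℝ) [hp : Fact (1 < p)] : Fact (1 ≤ ENNReal.ofReal p) :=
  ⟨by simpa using ENNReal.ofReal_le_ofReal hp.out.le⟩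

/-- `E` is a nonnegative functional such that `E ^ (1 / p)` is a seminorm. -/
def IsPEnergy (p : ℝ) {V : Type*} [AddCommGroup V] [Module ℝ V] (E : V → ℝ) : Prop :=
  (∀ u, 0 ≤ E u) ∧ ∃ s : Seminorm ℝ V, ∀ u, s u = E u ^ (1 / p)

/-- A `p`-energy form `(E, F)` whose domain `F` is a linear subspace of `L^p(X, m)`. -/
structure PEnergyForm (X : Type*) [MeasurableSpace X] (m : Measure X) (p : ℝ) [Fact (1 < p)] where
  F : Submodule ℝ (Lp ℝ (ENNReal.ofReal p) m)
  E : F → ℝ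
  isPEnergy : IsPEnergy p E

namespace PEnergyForm

variable {X : Type*} [MeasurableSpace X] {m : Measure X} {p : ℝ} [Fact (1 < p)]

/-- The value of an element of the domain at a point (through a representative). -/
def val (𝓔 : PEnergyForm X m p) (u : 𝓔.F) : X → ℝ := ((u : Lp ℝ (ENNReal.ofReal p) m) : X → ℝ)

/-- A copy of the domain `F`, to be equipped with the norm `‖u‖_{L^p} + E(u)^{1/p}`. -/
def Dom (𝓔 : PEnergyForm X m p) : Type _ := 𝓔.F

/-- The identification of the domain with its normed copy. -/
def toDom (𝓔 : PEnergyForm X m p) (u : 𝓔.F) : 𝓔.Dom := u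

instance (𝓔 : PEnergyForm X m p) : AddCommGroup 𝓔.Dom := inferInstanceAs (AddCommGroup 𝓔.F)

instance (𝓔 : PEnergyForm X m p) : Module ℝ 𝓔.Dom := inferInstanceAs (Module ℝ 𝓔.F)

/-- The norm `‖u‖ + E(u)^{1/p}` on the domain. -/
def domNorm (𝓔 : PEnergyForm X m p) (u : 𝓔.F) : ℝ :=
  ‖(u : Lp ℝ (ENNReal.ofReal p) m)‖ + 𝓔.E u ^ (1 / p)

instance (𝓔 : PEnergyForm X m p) : Norm 𝓔.Dom := ⟨fun u => 𝓔.domNorm u⟩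

theorem domCore (𝓔 : PEnergyForm X m p) : NormedSpace.Core ℝ 𝓔.Dom := by
  obtain ⟨s, hs⟩ := 𝓔.isPEnergy.2
  have key : ∀ u : 𝓔.F, 𝓔.domNorm u = ‖(u : Lp ℝ (ENNReal.ofReal p) m)‖ + s u := by
    intro u
    rw [hs u]
    rfl
  have h1 : ∀ u : 𝓔.F, 0 ≤ 𝓔.domNorm u := by
    intro u
    rw [key]
    exact add_nonneg (norm_nonneg _) (apply_nonneg s u)
  have h2 : ∀ (c : ℝ) (u : 𝓔.F), 𝓔.domNorm (c • u) = ‖c‖ * 𝓔.domNorm u := by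
    intro c u
    rw [key, key, map_smul_eq_mul, Submodule.coe_smul, norm_smul, mul_add]
  have h3 : ∀ u v : 𝓔.F, 𝓔.domNorm (u + v) ≤ 𝓔.domNorm u + 𝓔.domNorm v := by
    intro u v
    rw [key, key, key, Submodule.coe_add]
    linarith [norm_add_le (u : Lp ℝ (ENNReal.ofReal p) m) v, map_add_le_add s u v]
  have h4 : ∀ u : 𝓔.F, 𝓔.domNorm u = 0 ↔ u = 0 := by
    intro u
    rw [key]
    constructor
    · intro h
      have h5 : ‖(u : Lp ℝ (ENNReal.ofReal p) m)‖ = 0 := by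
        linarith [norm_nonneg (u : Lp ℝ (ENNReal.ofReal p) m), apply_nonneg s u]
      exact Subtype.ext (norm_eq_zero.1 h5)
    · rintro rfl
      simp
  exact
    { norm_nonneg := h1
      norm_smul := h2
      norm_triangle := h3
      norm_eq_zero_iff := h4 }

instance (𝓔 : PEnergyForm X m p) : NormedAddCommGroup 𝓔.Dom :=
  NormedAddCommGroup.ofCore 𝓔.domCore

instance (𝓔 : PEnergyForm X m p) : NormedSpace ℝ 𝓔.Dom :=
  NormedSpace.ofCore 𝓔.domCore

end PEnergyForm

/-- A regular, strongly local `p`-energy form on `(X, m)` whose domain is a reflexive Banach space,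
together with its `p`-energy measures `Γ u`. -/
structure PEnergyStructure (X : Type*) [MetricSpace X] [MeasurableSpace X] [BorelSpace X]
    (m : Measure X) (p : ℝ) [Fact (1 < p)] extends PEnergyForm X m p where
  /-- the energy measures -/
  Γ : toPEnergyForm.F → Measure X
  finite_Γ : ∀ u, IsFiniteMeasure (Γ u)
  /-- Lipschitz contraction property -/
  lipschitz_contraction : ∀ (u : toPEnergyForm.F) (φ : ℝ → ℝ), LipschitzWith 1 φ → φ 0 = 0 →
    ∃ v : toPEnergyForm.F, toPEnergyForm.val v =ᵐ[m] (fun x => φ (toPEnergyForm.val u x)) ∧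
      toPEnergyForm.E v ≤ toPEnergyForm.E u
  /-- functions of zero energy are constant -/
  const_of_energy_zero : ∀ u : toPEnergyForm.F, toPEnergyForm.E u = 0 →
    ∃ c : ℝ, toPEnergyForm.val u =ᵐ[m] fun _ => c
  complete : CompleteSpace toPEnergyForm.Dom
  reflexive : Function.Surjective (NormedSpace.inclusionInDoubleDual ℝ toPEnergyForm.Dom)
  /-- `F ∩ C_c(X)` is dense in `F` -/
  dense_domain : Dense {w : toPEnergyForm.Dom | ∃ (u : toPEnergyForm.F) (f : C_c(X, ℝ)),
    toPEnergyForm.toDom u = w ∧ toPEnergyForm.val u =ᵐ[m] f}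
  /-- `F ∩ C_c(X)` is uniformly dense in `C_c(X)` -/
  dense_continuous : ∀ (f : C_c(X, ℝ)) (ε : ℝ), 0 < ε → ∃ (g : C_c(X, ℝ)) (u : toPEnergyForm.F),
    toPEnergyForm.val u =ᵐ[m] g ∧ ∀ x, |f x - g x| ≤ ε
  isPEnergy_Γ : ∀ A : Set X, MeasurableSet A → IsPEnergy p fun u => (Γ u).real A
  energy_eq : ∀ u, toPEnergyForm.E u = (Γ u).real univ
  /-- strong locality -/
  strongly_local : ∀ (u v : toPEnergyForm.F) (f g : C_c(X, ℝ)),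
    toPEnergyForm.val u =ᵐ[m] f → toPEnergyForm.val v =ᵐ[m] g →
    ∀ U : Set X, IsOpen U → (∃ c : ℝ, ∀ x ∈ U, f x - g x = c) →
      (Γ u).restrict U = (Γ v).restrict U

/-- Volume doubling. -/
def VolumeDoubling {X : Type*} [MetricSpace X] [MeasurableSpace X] (m : Measure X) : Prop :=
  ∃ c : ℝ, 1 ≤ c ∧ ∀ (x : X) (r : ℝ), 0 < r →
    m (Metric.ball x (2 * r)) ≤ ENNReal.ofReal c * m (Metric.ball x r)

/-- `Ψ` restricts to a continuous increasing bijection of `(0, ∞)` satisfying two-sided power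
bounds; its values outside `(0, ∞)` play no role. -/
structure IsScaleFunction (Ψ : ℝ → ℝ) : Prop where
  continuousOn : ContinuousOn Ψ (Ioi 0)
  strictMonoOn : StrictMonoOn Ψ (Ioi 0)
  bijOn : BijOn Ψ (Ioi 0) (Ioi 0)
  bounds : ∃ C β₁ β₂ : ℝ, 1 ≤ C ∧ 0 < β₁ ∧ 0 < β₂ ∧ ∀ r R : ℝ, 0 < r → r ≤ R →
    C⁻¹ * (R / r) ^ β₁ ≤ Ψ R / Ψ r ∧ Ψ R / Ψ r ≤ C * (R / r) ^ β₂

namespace PEnergyStructure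

variable {X : Type*} [MetricSpace X] [MeasurableSpace X] [BorelSpace X]
  {m : Measure X} {p : ℝ} [Fact (1 < p)]

/-- The `(p, p)`-Poincaré inequality with scale function `Ψ`. -/
def PoincareInequality (𝓔 : PEnergyStructure X m p) (Ψ : ℝ → ℝ) : Prop :=
  ∃ C A : ℝ, 0 < C ∧ 1 ≤ A ∧ ∀ (x : X) (r : ℝ), 0 < r → ∀ u : 𝓔.F,
    ∫⁻ y in Metric.ball x r, ENNReal.ofReal (|𝓔.val u y - ⨍ z in Metric.ball x r, 𝓔.val u z ∂m| ^ p) ∂m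
      ≤ ENNReal.ofReal (C * Ψ r) * 𝓔.Γ u (Metric.ball x (A * r))

/-- The functions of `F` that are `1` a.e. on `E₁` and `0` a.e. on `E₀`. -/
def cutoffs (𝓔 : PEnergyStructure X m p) (E₁ E₀ : Set X) : Set 𝓔.F :=
  {u | (∀ᵐ x ∂m, x ∈ E₁ → 𝓔.val u x = 1) ∧ ∀ᵐ x ∂m, x ∈ E₀ → 𝓔.val u x = 0}

/-- The `p`-capacity upper estimate; the infimum is taken in `[0, ∞]`, so that it is `∞` if there
is no admissible function. -/
def CapacityUpper (𝓔 : PEnergyStructure X m p) (Ψ : ℝ → ℝ) : Prop :=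
  ∃ C A₁ A₂ : ℝ, 1 < C ∧ 1 < A₁ ∧ 1 < A₂ ∧ ∀ (x : X) (R : ℝ), 0 < R →
    ENNReal.ofReal R < Metric.ediam (univ : Set X) / ENNReal.ofReal A₂ →
    ⨅ u ∈ 𝓔.cutoffs (Metric.ball x R) (Metric.ball x (A₁ * R))ᶜ, ENNReal.ofReal (𝓔.E u)
      ≤ ENNReal.ofReal C * (m (Metric.ball x R) / ENNReal.ofReal (Ψ R))

/-- `A` is a relatively compact open subset of `U`. -/
def IsRelCompactOpenIn (A U : Set X) : Prop :=
  IsOpen A ∧ IsCompact (closure A) ∧ closure A ⊆ U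

/-- The local space `F_loc(U)`. Functions on `U` are represented by functions on `X`, whose values
off `U` play no role. -/
def MemLoc (𝓔 : PEnergyStructure X m p) (U : Set X) (u : X → ℝ) : Prop :=
  AEMeasurable u (m.restrict U) ∧
    ∀ A : Set X, IsRelCompactOpenIn A U → ∃ w : 𝓔.F, u =ᵐ[m.restrict A] 𝓔.val w

/-- The energy measure on `U` of `u ∈ F_loc(U)`: on each relatively compact open subset `A` of `U`
it is `Γ w` for any `w ∈ F` that agrees with `u` a.e. on `A`; it is the (directed) supremum of these
measures over all `A`, which is their limit along any exhaustion of `U`. -/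
def localΓ (𝓔 : PEnergyStructure X m p) (U : Set X) (u : X → ℝ) : Measure X :=
  ⨆ (A : Set X) (_ : IsRelCompactOpenIn A U) (w : 𝓔.F) (_ : u =ᵐ[m.restrict A] 𝓔.val w),
    (𝓔.Γ w).restrict A

/-- The space `F(U)`. -/
def MemOn (𝓔 : PEnergyStructure X m p) (U : Set X) (u : X → ℝ) : Prop :=
  𝓔.MemLoc U u ∧ (∫⁻ x in U, ENNReal.ofReal (|u x| ^ p) ∂m) + 𝓔.localΓ U u U < ∞

/-- The extension property of an open set `Ω ≠ X`. -/
def ExtensionProperty (𝓔 : PEnergyStructure X m p) (Ω : Set X) : Prop :=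
  IsOpen Ω ∧ Ω ≠ univ ∧ ∀ f : X → ℝ, 𝓔.MemOn Ω f →
    ∃ w : 𝓔.F, f =ᵐ[m.restrict Ω] 𝓔.val w ∧ 𝓔.Γ w (frontier Ω) = 0

end PEnergyStructure

/-- `∫_Ω m(B(y,r))⁻¹ ∫_{Ω ∩ B(y,r)} |u(x) - u(y)|^p / Ψ(r) m(dx) m(dy)`. -/
def ksEnergy {X : Type*} [MetricSpace X] [MeasurableSpace X] (m : Measure X) (p : ℝ) (Ψ : ℝ → ℝ)
    (Ω : Set X) (u : X → ℝ) (r : ℝ) : ℝ≥0∞ :=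
  ∫⁻ y in Ω, (m (Metric.ball y r))⁻¹ *
    ∫⁻ x in Ω ∩ Metric.ball y r, ENNReal.ofReal (|u x - u y| ^ p / Ψ r) ∂m ∂m

/-- `∫_Ω m(B(y,r))⁻¹ ∫_{Ω ∩ B(y,r)} |u(x) - u(y)|^p / Ψ(d(x,y)) m(dx) m(dy)`; the integrand is
`0` for `x = y`. -/
def ksEnergyDist {X : Type*} [MetricSpace X] [MeasurableSpace X] (m : Measure X) (p : ℝ)
    (Ψ : ℝ → ℝ) (Ω : Set X) (u : X → ℝ) (r : ℝ) : ℝ≥0∞ :=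
  ∫⁻ y in Ω, (m (Metric.ball y r))⁻¹ *
    ∫⁻ x in Ω ∩ Metric.ball y r, ENNReal.ofReal (|u x - u y| ^ p / Ψ (dist x y)) ∂m ∂m

end

open scoped NNReal

noncomputable section

/-! ### Weak limits in reflexive spaces -/

/-! Upper bounds come from Poincaré, lower bounds from discrete approximation and weak compactness.

Upper bounds. Covering by a net of balls with bounded overlap and applying the Poincaré inequality
on each gives `exists_lintegral_meanOsc_le`: the mean oscillation at scale `s`, integrated over `D`,
is at most a constant times `Ψ(s)` times the energy near `D`. For the weight `1/Ψ(d(x,y))` the ball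
is cut into the shells `r/16^(k+1) ≤ d(x,y) < r/16^k`. Each shell costs an oscillation at its own
scale, but is normalized by the larger volume `m(B(y,r))`; reverse volume doubling turns this
mismatch into a factor `θ^k` with `θ < 1`, and the series converges. Reverse doubling follows from
doubling because spheres that should meet the space do: otherwise some ball would be open and
closed, and its indicator would be a nonconstant function of zero energy.

Lower bounds. The capacity estimate supplies cutoffs on the balls of an `r`-net, and these yield a
partition of unity. Averaging `u` over the balls gives approximations `v` (`exists_approx`) whose
energy on `A` is controlled by the oscillation of `u` near `A`, divided by `Ψ(r)`. As `r → 0` along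
radii realizing the liminf, `v → u` in `L^p` with bounded energies, and `Γ⟨·⟩(A)` is lower
semicontinuous under such convergence by reflexivity (`Γ_le_of_tendsto`). Density of `F ∩ C_c(X)`
then removes the bounded support assumption.

Both halves compare `v` or local functions with elements of `F` on open sets where they differ by a
constant. Strong locality is assumed only for continuous compactly supported functions, so
`Γ_eq_zero_of_ae_const` first extends it to all of `F`. On a domain, the extension property reduces
to `u ∈ F`; inner regularity by compact sets gives the lower bound, and the null boundary energy
gives the upper one. -/

theorem mem_of_tendsto_of_reflexive {V W : Type*} [NormedAddCommGroup V] [NormedSpace ℝ V]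
    [NormedAddCommGroup W] [NormedSpace ℝ W]
    (hV : Function.Surjective (NormedSpace.inclusionInDoubleDual ℝ V))
    (T : V →L[ℝ] W) (hT : Function.Injective T) {P : Set V} (hPc : Convex ℝ P)
    (hP : IsClosed P) {u : ℕ → V} {b : ℝ} (hb : ∀ n, ‖u n‖ ≤ b) (hu : ∀ n, u n ∈ P) {w : V}
    (hw : Tendsto (fun n => T (u n)) atTop (𝓝 (T w))) : w ∈ P := by
  -- Reflexivity makes the weak closure of the bounded sequence compact, so a free ultrafilter on
  -- the indices yields a weak limit `v` without extracting a subsequence.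
  set S : Set (WeakSpace ℝ V) := toWeakSpace ℝ V '' range u
  have hS : IsCompact (closure S) := by
    apply NormedSpace.isCompact_closure_of_isBounded
    · rw [preimage_image_eq _ (toWeakSpace ℝ V).injective]
      exact (Metric.isBounded_closedBall (x := (0 : V)) (r := b)).subset
        (by rintro _ ⟨n, rfl⟩; simpa using hb n)
    · intro ξ _
      obtain ⟨v, hv⟩ := hV (StrongDual.toWeakDual.symm ξ)
      refine ⟨toWeakSpace ℝ V v, ?_⟩
      exact congrArg StrongDual.toWeakDual hv
  have hle : (((hyperfilter ℕ).map fun n => toWeakSpace ℝ V (u n) : Ultrafilter _) :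
      Filter (WeakSpace ℝ V)) ≤ 𝓟 (closure S) := by
    rw [le_principal_iff]
    refine mem_map.2 (Eventually.of_forall fun n => subset_closure ⟨u n, ⟨n, rfl⟩, rfl⟩)
  obtain ⟨x, -, hx⟩ := hS.ultrafilter_le_nhds _ hle
  obtain ⟨v, rfl⟩ := (toWeakSpace ℝ V).surjective x
  have hx' : Tendsto (fun n => toWeakSpace ℝ V (u n)) (hyperfilter ℕ : Filter ℕ)
      (𝓝 (toWeakSpace ℝ V v)) := hx
  have hf : ∀ f : StrongDual ℝ V, Tendsto (fun n => f (u n)) (hyperfilter ℕ : Filter ℕ)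
      (𝓝 (f v)) := fun f =>
    ((WeakBilin.eval_continuous (topDualPairing ℝ V).flip f).tendsto _).comp hx'
  -- Functionals of the form `g ∘ T` see both limits, so `T v = T w`. Membership in `P` then follows
  -- since a closed convex set can be strictly separated from an outside point.
  have hvw : v = w := by
    apply hT
    refine (SeparatingDual.eq_iff_forall_dual_eq (R := ℝ)).2 fun g => ?_
    have h1 := hf (g.comp T)
    have h2 : Tendsto (fun n => g (T (u n))) (hyperfilter ℕ : Filter ℕ) (𝓝 (g (T w))) :=
      ((g.continuous.tendsto _).comp hw).mono_left Nat.hyperfilter_le_atTop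
    exact tendsto_nhds_unique h1 h2
  subst hvw
  by_contra hv
  obtain ⟨f, s, h1, h2⟩ := geometric_hahn_banach_closed_point hPc hP hv
  exact absurd (le_of_tendsto (hf f) (Eventually.of_forall fun n => (h1 _ (hu n)).le)) (not_le.2 h2)

namespace PEnergyStructure

variable {X : Type*} [MetricSpace X] [MeasurableSpace X] [BorelSpace X]
  {m : Measure X} {p : ℝ} [Fact (1 < p)]

instance (𝓔 : PEnergyStructure X m p) (u : 𝓔.F) : IsFiniteMeasure (𝓔.Γ u) := 𝓔.finite_Γ u

theorem one_lt_exponent (p : ℝ) [hp : Fact (1 < p)] : 1 < p := hp.out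

theorem exponent_pos (p : ℝ) [hp : Fact (1 < p)] : 0 < p := by linarith [hp.out]

/-! ### The domain -/

theorem measurable_val (𝓔 : PEnergyStructure X m p) (u : 𝓔.F) : Measurable (𝓔.val u) :=
  (Lp.stronglyMeasurable _).measurable

theorem val_add (𝓔 : PEnergyStructure X m p) (u v : 𝓔.F) :
    𝓔.val (u + v) =ᵐ[m] 𝓔.val u + 𝓔.val v := Lp.coeFn_add _ _

theorem val_sub (𝓔 : PEnergyStructure X m p) (u v : 𝓔.F) :
    𝓔.val (u - v) =ᵐ[m] 𝓔.val u - 𝓔.val v := Lp.coeFn_sub _ _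

theorem val_smul (𝓔 : PEnergyStructure X m p) (c : ℝ) (u : 𝓔.F) :
    𝓔.val (c • u) =ᵐ[m] c • 𝓔.val u := Lp.coeFn_smul _ _

theorem val_zero (𝓔 : PEnergyStructure X m p) : 𝓔.val 0 =ᵐ[m] 0 := Lp.coeFn_zero _ _ _

theorem val_sum (𝓔 : PEnergyStructure X m p) {ι : Type*} (s : Finset ι) (u : ι → 𝓔.F) :
    ∀ᵐ x ∂m, 𝓔.val (∑ i ∈ s, u i) x = ∑ i ∈ s, 𝓔.val (u i) x := by
  classical
  induction s using Finset.induction_on with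
  | empty =>
    filter_upwards [𝓔.val_zero] with x hx
    simpa using hx
  | insert a s ha ih =>
    rw [Finset.sum_insert ha]
    filter_upwards [ih, 𝓔.val_add (u a) (∑ i ∈ s, u i)] with x h1 h2
    rw [h2, Finset.sum_insert ha, Pi.add_apply, h1]

/-! ### The energy measures as functions of `u` -/

/-- The seminorm `u ↦ Γ⟨u⟩(A)^{1/p}`. -/
def seminormΓ (𝓔 : PEnergyStructure X m p) (A : Set X) (hA : MeasurableSet A) :
    Seminorm ℝ 𝓔.F := (𝓔.isPEnergy_Γ A hA).2.choose

theorem seminormΓ_apply (𝓔 : PEnergyStructure X m p) {A : Set X} (hA : MeasurableSet A)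
    (u : 𝓔.F) : 𝓔.seminormΓ A hA u = (𝓔.Γ u).real A ^ (1 / p) :=
  (𝓔.isPEnergy_Γ A hA).2.choose_spec u

theorem rpow_Γ_eq (𝓔 : PEnergyStructure X m p) {A : Set X} (hA : MeasurableSet A)
    (u : 𝓔.F) : 𝓔.Γ u A ^ (1 / p) = ENNReal.ofReal (𝓔.seminormΓ A hA u) := by
  have := exponent_pos p
  rw [seminormΓ_apply, ← ENNReal.ofReal_rpow_of_nonneg measureReal_nonneg (by positivity),
    ofReal_measureReal]

theorem Γ_eq (𝓔 : PEnergyStructure X m p) {A : Set X} (hA : MeasurableSet A)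
    (u : 𝓔.F) : 𝓔.Γ u A = ENNReal.ofReal (𝓔.seminormΓ A hA u) ^ p := by
  have := exponent_pos p
  rw [← 𝓔.rpow_Γ_eq, ← ENNReal.rpow_mul, one_div_mul_cancel this.ne', ENNReal.rpow_one]

theorem rpow_Γ_add_le (𝓔 : PEnergyStructure X m p) {A : Set X} (hA : MeasurableSet A)
    (u v : 𝓔.F) :
    𝓔.Γ (u + v) A ^ (1 / p) ≤ 𝓔.Γ u A ^ (1 / p) + 𝓔.Γ v A ^ (1 / p) := by
  rw [𝓔.rpow_Γ_eq hA, 𝓔.rpow_Γ_eq hA, 𝓔.rpow_Γ_eq hA,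
    ← ENNReal.ofReal_add (apply_nonneg _ _) (apply_nonneg _ _)]
  exact ENNReal.ofReal_le_ofReal (map_add_le_add _ _ _)

theorem Γ_smul (𝓔 : PEnergyStructure X m p) {A : Set X} (hA : MeasurableSet A)
    (c : ℝ) (u : 𝓔.F) : 𝓔.Γ (c • u) A = ENNReal.ofReal (|c| ^ p) * 𝓔.Γ u A := by
  have := exponent_pos p
  rw [𝓔.Γ_eq hA, 𝓔.Γ_eq hA, map_smul_eq_mul, Real.norm_eq_abs,
    ENNReal.ofReal_mul (abs_nonneg c), ENNReal.mul_rpow_of_nonneg _ _ this.le,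
    ENNReal.ofReal_rpow_of_nonneg (abs_nonneg c) this.le]

theorem Γ_zero (𝓔 : PEnergyStructure X m p) {A : Set X} (hA : MeasurableSet A) :
    𝓔.Γ 0 A = 0 := by
  simp [𝓔.Γ_eq hA, exponent_pos p]

theorem Γ_neg (𝓔 : PEnergyStructure X m p) {A : Set X} (hA : MeasurableSet A) (u : 𝓔.F) :
    𝓔.Γ (-u) A = 𝓔.Γ u A := by
  rw [𝓔.Γ_eq hA, 𝓔.Γ_eq hA, map_neg_eq_map]

theorem rpow_Γ_sub_le (𝓔 : PEnergyStructure X m p) {A : Set X} (hA : MeasurableSet A)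
    (u v : 𝓔.F) :
    𝓔.Γ (u - v) A ^ (1 / p) ≤ 𝓔.Γ u A ^ (1 / p) + 𝓔.Γ v A ^ (1 / p) := by
  have := 𝓔.rpow_Γ_add_le hA u (-v)
  rwa [← sub_eq_add_neg, 𝓔.Γ_neg hA] at this

theorem rpow_Γ_sum_le (𝓔 : PEnergyStructure X m p) {A : Set X} (hA : MeasurableSet A)
    {ι : Type*} (s : Finset ι) (u : ι → 𝓔.F) :
    𝓔.Γ (∑ i ∈ s, u i) A ^ (1 / p) ≤ ∑ i ∈ s, 𝓔.Γ (u i) A ^ (1 / p) := by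
  have := exponent_pos p
  refine Finset.le_sum_of_subadditive (fun u => 𝓔.Γ u A ^ (1 / p)) ?_ (𝓔.rpow_Γ_add_le hA) s u
  simp [𝓔.Γ_zero hA, this]

theorem Γ_le_of_rpow_le (𝓔 : PEnergyStructure X m p) {A : Set X} {u : 𝓔.F} {b : ℝ≥0∞}
    (h : 𝓔.Γ u A ^ (1 / p) ≤ b) : 𝓔.Γ u A ≤ b ^ p := by
  have hp := exponent_pos p
  have := ENNReal.rpow_le_rpow h hp.le
  rwa [← ENNReal.rpow_mul, one_div_mul_cancel hp.ne', ENNReal.rpow_one] at this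

/-- Only the `p`-th root of the energy is subadditive; the triangle inequality is applied there,
which costs the power `p` of the number of terms. -/
theorem Γ_sum_le (𝓔 : PEnergyStructure X m p) {A : Set X} (hA : MeasurableSet A)
    {ι : Type*} (s : Finset ι) (u : ι → 𝓔.F) {b : ℝ≥0∞} (hb : ∀ i ∈ s, 𝓔.Γ (u i) A ≤ b) :
    𝓔.Γ (∑ i ∈ s, u i) A ≤ (s.card : ℝ≥0∞) ^ p * b := by
  have hp := exponent_pos p
  have h1 : 𝓔.Γ (∑ i ∈ s, u i) A ^ (1 / p) ≤ s.card * b ^ (1 / p) := by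
    refine (𝓔.rpow_Γ_sum_le hA s u).trans ?_
    rw [← nsmul_eq_mul]
    exact Finset.sum_le_card_nsmul _ _ _ fun i hi =>
      ENNReal.rpow_le_rpow (hb i hi) (by positivity)
  refine (𝓔.Γ_le_of_rpow_le h1).trans_eq ?_
  rw [ENNReal.mul_rpow_of_nonneg _ _ hp.le, ← ENNReal.rpow_mul, one_div_mul_cancel hp.ne',
    ENNReal.rpow_one]

theorem Γ_add_le (𝓔 : PEnergyStructure X m p) {A : Set X} (hA : MeasurableSet A)
    (u v : 𝓔.F) : 𝓔.Γ (u + v) A ≤ 2 ^ p * (𝓔.Γ u A + 𝓔.Γ v A) := by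
  have h := 𝓔.Γ_sum_le hA (Finset.univ : Finset Bool) (fun i => if i then u else v)
    (b := 𝓔.Γ u A + 𝓔.Γ v A) (by
      intro i _
      cases i <;> simp)
  simpa using h

theorem ofReal_E (𝓔 : PEnergyStructure X m p) (u : 𝓔.F) :
    ENNReal.ofReal (𝓔.E u) = 𝓔.Γ u univ := by
  rw [𝓔.energy_eq, ofReal_measureReal]

theorem seminormΓ_le_norm (𝓔 : PEnergyStructure X m p) {A : Set X} (hA : MeasurableSet A)
    (u : 𝓔.F) : 𝓔.seminormΓ A hA u ≤ ‖𝓔.toDom u‖ := by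
  have hp := exponent_pos p
  have h1 : ‖𝓔.toDom u‖ = ‖(u : Lp ℝ (ENNReal.ofReal p) m)‖ + 𝓔.E u ^ (1 / p) := rfl
  rw [h1, 𝓔.seminormΓ_apply, 𝓔.energy_eq]
  have : (𝓔.Γ u).real A ^ (1 / p) ≤ (𝓔.Γ u).real univ ^ (1 / p) :=
    Real.rpow_le_rpow measureReal_nonneg (measureReal_mono (subset_univ _)) (by positivity)
  linarith [norm_nonneg (u : Lp ℝ (ENNReal.ofReal p) m)]

/-- The identification of the normed copy with the domain. -/
def ofDom (𝓔 : PEnergyStructure X m p) : 𝓔.Dom →ₗ[ℝ] 𝓔.F where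
  toFun u := u
  map_add' _ _ := rfl
  map_smul' _ _ := rfl

theorem norm_dom_eq (𝓔 : PEnergyStructure X m p) (u : 𝓔.Dom) :
    ‖u‖ = ‖(𝓔.ofDom u : Lp ℝ (ENNReal.ofReal p) m)‖ + 𝓔.E (𝓔.ofDom u) ^ (1 / p) := rfl

/-- The inclusion of the domain into `L^p`. -/
def inclLp (𝓔 : PEnergyStructure X m p) : 𝓔.Dom →L[ℝ] Lp ℝ (ENNReal.ofReal p) m :=
  LinearMap.mkContinuous (𝓔.F.subtype ∘ₗ 𝓔.ofDom) 1 (by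
    intro u
    have : 0 ≤ 𝓔.E (𝓔.ofDom u) ^ (1 / p) := Real.rpow_nonneg (𝓔.isPEnergy.1 _) _
    rw [𝓔.norm_dom_eq, one_mul]
    simpa using this)

/-- The seminorm `u ↦ Γ⟨u⟩(A)^{1/p}` on the normed copy of the domain. -/
def domSeminormΓ (𝓔 : PEnergyStructure X m p) (A : Set X) (hA : MeasurableSet A) :
    Seminorm ℝ 𝓔.Dom := (𝓔.seminormΓ A hA).comp 𝓔.ofDom

theorem domSeminormΓ_le_norm (𝓔 : PEnergyStructure X m p) {A : Set X} (hA : MeasurableSet A)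
    (u : 𝓔.Dom) : 𝓔.domSeminormΓ A hA u ≤ ‖u‖ := 𝓔.seminormΓ_le_norm hA (𝓔.ofDom u)

theorem isClosed_closedBall_domSeminormΓ (𝓔 : PEnergyStructure X m p) {A : Set X}
    (hA : MeasurableSet A) (c : ℝ) : IsClosed ((𝓔.domSeminormΓ A hA).closedBall 0 c) := by
  have hc : LipschitzWith 1 (𝓔.domSeminormΓ A hA) := by
    refine LipschitzWith.of_le_add fun u v => ?_
    rw [dist_eq_norm]
    have h1 := map_add_le_add (𝓔.domSeminormΓ A hA) v (u - v)
    rw [add_sub_cancel] at h1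
    linarith [𝓔.domSeminormΓ_le_norm hA (u - v)]
  rw [Seminorm.closedBall_zero_eq]
  exact isClosed_le hc.continuous continuous_const

/-- Lower semicontinuity: balls of the seminorm `Γ⟨·⟩(A)^{1/p}` are convex and closed in the domain,
hence weakly closed, and `L^p` convergence with bounded total energy identifies the weak limit. -/
theorem Γ_le_of_tendsto (𝓔 : PEnergyStructure X m p) {A : Set X} (hA : MeasurableSet A)
    {u : ℕ → 𝓔.F} {w : 𝓔.F} {b c : ℝ≥0∞} (hb : b ≠ ∞) (hub : ∀ n, 𝓔.Γ (u n) univ ≤ b)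
    (huc : ∀ n, 𝓔.Γ (u n) A ≤ c)
    (hw : Tendsto (fun n => (u n : Lp ℝ (ENNReal.ofReal p) m)) atTop (𝓝 w)) :
    𝓔.Γ w A ≤ c := by
  have hp := exponent_pos p
  obtain rfl | hc := eq_or_ne c ∞
  · exact le_top
  have key : 𝓔.toDom w ∈ (𝓔.domSeminormΓ A hA).closedBall 0 (c.toReal ^ (1 / p)) := by
    obtain ⟨K, hK⟩ := hw.norm.bddAbove_range
    refine mem_of_tendsto_of_reflexive (u := fun n => 𝓔.toDom (u n)) 𝓔.reflexive 𝓔.inclLp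
      (fun a b h => Subtype.ext h)
      ((𝓔.domSeminormΓ A hA).convex_closedBall _ _) (𝓔.isClosed_closedBall_domSeminormΓ hA _)
      (b := K + b.toReal ^ (1 / p)) (fun n => ?_) (fun n => ?_) hw
    · have h1 : ‖𝓔.toDom (u n)‖ = ‖(u n : Lp ℝ (ENNReal.ofReal p) m)‖ + 𝓔.E (u n) ^ (1 / p) := rfl
      refine h1.trans_le (add_le_add (hK ⟨n, rfl⟩) ?_)
      rw [𝓔.energy_eq]
      exact Real.rpow_le_rpow measureReal_nonneg (ENNReal.toReal_mono hb (hub n)) (by positivity)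
    · rw [Seminorm.mem_closedBall_zero]
      change 𝓔.seminormΓ A hA (u n) ≤ _
      rw [seminormΓ_apply]
      exact Real.rpow_le_rpow measureReal_nonneg (ENNReal.toReal_mono hc (huc n)) (by positivity)
  have key' : 𝓔.seminormΓ A hA w ≤ c.toReal ^ (1 / p) :=
    (𝓔.domSeminormΓ A hA).mem_closedBall_zero.1 key
  rw [𝓔.Γ_eq hA]
  calc _ ≤ ENNReal.ofReal (c.toReal ^ (1 / p)) ^ p :=
        ENNReal.rpow_le_rpow (ENNReal.ofReal_le_ofReal key') hp.le
    _ = c := by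
        rw [ENNReal.ofReal_rpow_of_nonneg (by positivity) hp.le, ← Real.rpow_mul (by positivity),
          one_div_mul_cancel hp.ne', Real.rpow_one, ENNReal.ofReal_toReal hc]

/-- Normal contractions operate on the domain. -/
theorem exists_contraction (𝓔 : PEnergyStructure X m p) (u : 𝓔.F) {φ : ℝ → ℝ}
    (hφ : LipschitzWith 1 φ) (h0 : φ 0 = 0) :
    ∃ v : 𝓔.F, 𝓔.val v =ᵐ[m] (fun x => φ (𝓔.val u x)) ∧ 𝓔.Γ v univ ≤ 𝓔.Γ u univ := by
  obtain ⟨v, h1, h2⟩ := 𝓔.lipschitz_contraction u φ hφ h0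
  exact ⟨v, h1, by rw [← 𝓔.ofReal_E, ← 𝓔.ofReal_E]; exact ENNReal.ofReal_le_ofReal h2⟩

/-! ### Convergence in `L^p` -/

theorem lintegral_rpow_eq (𝓔 : PEnergyStructure X m p) (u v : 𝓔.F) :
    eLpNorm (u - v : Lp ℝ (ENNReal.ofReal p) m) (ENNReal.ofReal p) m =
      (∫⁻ x, ENNReal.ofReal (|𝓔.val u x - 𝓔.val v x| ^ p) ∂m) ^ (1 / p) := by
  have hp := exponent_pos p
  rw [eLpNorm_congr_ae (Lp.coeFn_sub _ _), eLpNorm_eq_lintegral_rpow_enorm_toReal (by simpa using hp)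
    ENNReal.ofReal_ne_top, ENNReal.toReal_ofReal hp.le]
  congr 1
  refine lintegral_congr fun x => ?_
  rw [← ENNReal.ofReal_rpow_of_nonneg (abs_nonneg _) hp.le, ← Real.norm_eq_abs, ofReal_norm]
  rfl

theorem tendsto_Lp_of_lintegral (𝓔 : PEnergyStructure X m p) {u : ℕ → 𝓔.F} {w : 𝓔.F}
    (h : Tendsto (fun n => ∫⁻ x, ENNReal.ofReal (|𝓔.val (u n) x - 𝓔.val w x| ^ p) ∂m) atTop
      (𝓝 0)) :
    Tendsto (fun n => (u n : Lp ℝ (ENNReal.ofReal p) m)) atTop (𝓝 w) := by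
  have hp := exponent_pos p
  have h1 : Tendsto (fun n => (∫⁻ x, ENNReal.ofReal (|𝓔.val (u n) x - 𝓔.val w x| ^ p) ∂m)
      ^ (1 / p)) atTop (𝓝 0) := by
    have := h.ennrpow_const (1 / p)
    rwa [ENNReal.zero_rpow_of_pos (by positivity)] at this
  rw [tendsto_iff_edist_tendsto_0]
  refine h1.congr fun n => ?_
  rw [← 𝓔.lintegral_rpow_eq, Lp.edist_def]
  exact eLpNorm_congr_ae (Lp.coeFn_sub _ _)

theorem lintegral_val_lt_top (𝓔 : PEnergyStructure X m p) (u : 𝓔.F) :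
    ∫⁻ x, ENNReal.ofReal (|𝓔.val u x| ^ p) ∂m < ∞ := by
  have hp := exponent_pos p
  have h := 𝓔.lintegral_rpow_eq u 0
  have h0 : ∫⁻ x, ENNReal.ofReal (|𝓔.val u x - 𝓔.val 0 x| ^ p) ∂m =
      ∫⁻ x, ENNReal.ofReal (|𝓔.val u x| ^ p) ∂m := by
    refine lintegral_congr_ae ?_
    filter_upwards [𝓔.val_zero] with x hx
    rw [hx]
    simp
  rw [h0] at h
  have h2 := Lp.eLpNorm_lt_top (u - (0 : 𝓔.F) : Lp ℝ (ENNReal.ofReal p) m)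
  rw [h] at h2
  exact (ENNReal.rpow_lt_top_iff_of_pos (by positivity)).1 h2

/-! ### Cutoff functions and strong locality on the domain -/

theorem exists_cutoff [LocallyCompactSpace X] (𝓔 : PEnergyStructure X m p) {K U : Set X}
    (hK : IsCompact K) (hU : IsOpen U) (hKU : K ⊆ U) :
    ∃ (χ : 𝓔.F) (g : C_c(X, ℝ)) (V : Set X), 𝓔.val χ =ᵐ[m] g ∧ IsOpen V ∧ K ⊆ V ∧
      (∀ x, 0 ≤ g x) ∧ (∀ x, g x ≤ 1) ∧ (∀ x ∈ V, g x = 1) ∧ ∀ x ∉ U, g x = 0 := by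
  obtain ⟨V, hV, hKV, hVU, hVc⟩ := exists_open_between_and_isCompact_closure hK hU hKU
  obtain ⟨f, hf1, hf0, hfc, -⟩ := exists_continuous_one_zero_of_isCompact hVc hU.isClosed_compl
    (disjoint_compl_right_iff_subset.2 hVU)
  obtain ⟨h, w, hw, hfh⟩ := 𝓔.dense_continuous ⟨f, hfc⟩ (1 / 4) (by norm_num)
  -- Since `h` is within `1/4` of the Urysohn function `f`, it is at least `3/4` where `f = 1` and
  -- at most `1/4` where `f = 0`. This `φ` takes the constant values `1/2` and `0` there; doubling
  -- gives a cutoff.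
  set φ : ℝ → ℝ := fun t => max (min (t - 1 / 4) (1 / 2)) 0 with hφ
  have hφl : LipschitzWith 1 φ :=
    ((LipschitzWith.of_le_add fun a b => by
      rw [Real.dist_eq]; linarith [le_abs_self (a - b)]).min_const _).max_const _
  have hφ0 : φ 0 = 0 := by norm_num [hφ]
  obtain ⟨v, hv, -⟩ := 𝓔.exists_contraction w hφl hφ0
  refine ⟨(2 : ℝ) • v, ⟨⟨fun x => 2 * φ (h x), continuous_const.mul
      (hφl.continuous.comp h.continuous)⟩,
    HasCompactSupport.comp_left (g := fun t => 2 * φ t) h.hasCompactSupport' (by simp [hφ0])⟩,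
    V, ?_, hV, hKV, fun x => ?_, fun x => ?_, fun x hx => ?_, fun x hx => ?_⟩
  · filter_upwards [hw, hv, 𝓔.val_smul 2 v] with x h1 h2 h3
    rw [h3, Pi.smul_apply, h2, h1]
    rfl
  · change 0 ≤ 2 * max (min (h x - 1 / 4) (1 / 2)) 0
    positivity
  · change 2 * max (min (h x - 1 / 4) (1 / 2)) 0 ≤ 1
    have : max (min (h x - 1 / 4) (1 / 2)) 0 ≤ 1 / 2 := max_le (min_le_right _ _) (by norm_num)
    linarith
  · change 2 * max (min (h x - 1 / 4) (1 / 2)) 0 = 1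
    have h1 : f x = 1 := hf1 (subset_closure hx)
    have h2 : |f x - h x| ≤ 1 / 4 := hfh x
    have h3 := (abs_le.1 h2).2
    rw [min_eq_right (by linarith), max_eq_left (by norm_num)]
    norm_num
  · change 2 * max (min (h x - 1 / 4) (1 / 2)) 0 = 0
    have h1 : f x = 0 := hf0 hx
    have h2 : |f x - h x| ≤ 1 / 4 := hfh x
    have h3 := (abs_le.1 h2).1
    rw [max_eq_right ((min_le_left _ _).trans (by linarith)), mul_zero]

theorem Γ_eq_zero_of_isCompact [SecondCountableTopology X] [LocallyCompactSpace X]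
    (𝓔 : PEnergyStructure X m p) (w : 𝓔.F) {U : Set X} (hU : IsOpen U)
    (h : ∀ K ⊆ U, IsCompact K → 𝓔.Γ w K = 0) : 𝓔.Γ w U = 0 := by
  rw [hU.measure_eq_iSup_isCompact]
  simpa using fun K h1 h2 => h K h1 h2

theorem Γ_eq_zero_of_continuous (𝓔 : PEnergyStructure X m p) (w : 𝓔.F) (f : C_c(X, ℝ))
    (hf : 𝓔.val w =ᵐ[m] f) {U : Set X} (hU : IsOpen U) {c : ℝ} (hc : ∀ x ∈ U, f x = c) :
    𝓔.Γ w U = 0 := by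
  have h := 𝓔.strongly_local w 0 f 0 hf 𝓔.val_zero U hU ⟨c, fun x hx => by simp [hc x hx]⟩
  have h2 := congrArg (fun μ => μ U) h
  simp only [Measure.restrict_apply_self] at h2
  rw [h2, 𝓔.Γ_zero hU.measurableSet]

theorem exists_seq_tendsto (𝓔 : PEnergyStructure X m p) (w : 𝓔.F) :
    ∃ (u : ℕ → 𝓔.F) (f : ℕ → C_c(X, ℝ)), (∀ n, 𝓔.val (u n) =ᵐ[m] f n) ∧
      (∀ n, 𝓔.Γ (w - u n) univ ≤ 1) ∧ Tendsto (fun n => 𝓔.Γ (w - u n) univ) atTop (𝓝 0) ∧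
      Tendsto (fun n => (u n : Lp ℝ (ENNReal.ofReal p) m)) atTop (𝓝 w) := by
  have hp := exponent_pos p
  obtain ⟨a, ha, hlim⟩ := mem_closure_iff_seq_limit.1 (𝓔.dense_domain (𝓔.toDom w))
  choose u f hu hf using ha
  have hn : Tendsto (fun n => ‖𝓔.toDom w - a n‖) atTop (𝓝 0) := by
    have := (tendsto_const_nhds (x := 𝓔.toDom w)).sub hlim
    rw [sub_self] at this
    simpa using this.norm
  have h1 : ∀ n, 𝓔.Γ (w - u n) univ ≤ ENNReal.ofReal ‖𝓔.toDom w - a n‖ ^ p := fun n => by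
    rw [𝓔.Γ_eq MeasurableSet.univ, ← hu n]
    exact ENNReal.rpow_le_rpow (ENNReal.ofReal_le_ofReal (𝓔.seminormΓ_le_norm _ (w - u n))) hp.le
  have h2 : Tendsto (fun n => ENNReal.ofReal ‖𝓔.toDom w - a n‖ ^ p) atTop (𝓝 0) := by
    have := (ENNReal.tendsto_ofReal hn).ennrpow_const p
    rwa [ENNReal.ofReal_zero, ENNReal.zero_rpow_of_pos hp] at this
  have h4 : Tendsto (fun n => 𝓔.Γ (w - u n) univ) atTop (𝓝 0) :=
    tendsto_of_tendsto_of_tendsto_of_le_of_le tendsto_const_nhds h2 (fun _ => zero_le) h1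
  have h5 : Tendsto (fun n => (u n : Lp ℝ (ENNReal.ofReal p) m)) atTop (𝓝 w) := by
    refine ((𝓔.inclLp.continuous.tendsto _).comp hlim).congr fun n => ?_
    rw [Function.comp_apply, ← hu n]
    rfl
  -- Dropping finitely many terms gives an energy bound valid for every index, as lower
  -- semicontinuity requires.
  obtain ⟨N, hN⟩ := eventually_atTop.1 (h4.eventually (Iic_mem_nhds one_pos))
  exact ⟨fun n => u (n + N), fun n => f (n + N), fun n => hf _, fun n => hN _ (Nat.le_add_left _ _),
    h4.comp (tendsto_add_atTop_nat N), h5.comp (tendsto_add_atTop_nat N)⟩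

theorem Γ_le_of_sub_le (𝓔 : PEnergyStructure X m p) {A : Set X} (hA : MeasurableSet A)
    (w u : 𝓔.F) : 𝓔.Γ u A ≤ 2 ^ p * (𝓔.Γ w A + 𝓔.Γ (w - u) A) := by
  have h1 := 𝓔.Γ_add_le hA w (-(w - u))
  rwa [𝓔.Γ_neg hA, ← sub_eq_add_neg, sub_sub_cancel] at h1

theorem two_rpow_ne_top (p : ℝ) [Fact (1 < p)] : (2 : ℝ≥0∞) ^ p ≠ ∞ :=
  ENNReal.rpow_ne_top_of_nonneg (exponent_pos p).le (by simp)

/-- Continuous approximations of `w` need not vanish near `K`. They are modified so that they do,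
keeping energies bounded and the same `L^p` limit; locality for continuous functions and lower
semicontinuity then apply. -/
theorem Γ_isCompact_eq_zero_of_bounded [LocallyCompactSpace X] (𝓔 : PEnergyStructure X m p)
    (w : 𝓔.F) {M : ℝ} (hM : 0 ≤ M) (hwM : ∀ᵐ x ∂m, |𝓔.val w x| ≤ M) {U K : Set X}
    (hU : IsOpen U) (hw : ∀ᵐ x ∂m, x ∈ U → 𝓔.val w x = 0) (hK : IsCompact K) (hKU : K ⊆ U) :
    𝓔.Γ w K = 0 := by
  have hp := exponent_pos p
  obtain ⟨χ, g, V, hχ, hV, hKV, hg0, hg1, hgV, hgU⟩ := 𝓔.exists_cutoff hK hU hKU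
  obtain ⟨u, f, huf, hu1, -, hu⟩ := 𝓔.exists_seq_tendsto w
  -- This is `s` truncated to the interval `[-M(1-t), M(1-t)]`, with `t` the cutoff: zero near `K`,
  -- and the identity on the values of `w`. The form shown uses only truncations at constant levels
  -- and additions of multiples of the cutoff, operations the domain is known to allow.
  set B : ℝ → ℝ → ℝ := fun s t => max (min (s + M * t) M - 2 * M * t) (-M) + M * t with hB
  have hBl : ∀ s s' t, |B s t - B s' t| ≤ |s - s'| := fun s s' t => by
    simp only [hB, add_sub_add_right_eq_sub]
    refine (abs_max_sub_max_le_abs _ _ _).trans ?_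
    rw [sub_sub_sub_cancel_right]
    refine (abs_min_sub_min_le_max _ _ _ _).trans ?_
    simp
  have hB0 : B 0 0 = 0 := by simp [hB, hM]
  have hBw : ∀ᵐ x ∂m, B (𝓔.val w x) (g x) = 𝓔.val w x := by
    filter_upwards [hwM, hw] with x h1 h2
    have h3 := abs_le.1 h1
    by_cases hx : x ∈ U
    · rw [h2 hx]
      have h4 : 0 ≤ M * g x := mul_nonneg hM (hg0 x)
      have h5 : M * g x ≤ M := mul_le_of_le_one_right hM (hg1 x)
      simp only [hB]
      rw [zero_add, min_eq_left h5, max_eq_left] <;> linarith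
    · simp only [hB]
      rw [hgU x hx, mul_zero, mul_zero, add_zero, sub_zero, add_zero, min_eq_left h3.2,
        max_eq_left h3.1]
  have hc1 : LipschitzWith 1 fun t : ℝ => min t M := LipschitzWith.id.min_const _
  have hc2 : LipschitzWith 1 fun t : ℝ => max t (-M) := LipschitzWith.id.max_const _
  choose a ha hae using fun n => 𝓔.exists_contraction (u n + M • χ) hc1 (min_eq_left hM)
  choose b hb hbe using fun n =>
    𝓔.exists_contraction (a n - (2 * M) • χ) hc2 (max_eq_left (by linarith))
  have hval : ∀ n, ∀ᵐ x ∂m, 𝓔.val (b n + M • χ) x = B (𝓔.val (u n) x) (g x) := fun n => by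
    filter_upwards [ha n, hb n, hχ, 𝓔.val_add (b n) (M • χ), 𝓔.val_smul M χ,
      𝓔.val_sub (a n) ((2 * M) • χ), 𝓔.val_smul (2 * M) χ, 𝓔.val_add (u n) (M • χ)]
      with x h1 h2 h3 h4 h5 h6 h7 h8
    rw [h4, Pi.add_apply, h2, h6, Pi.sub_apply, h1, h8, Pi.add_apply, h5, h7, Pi.smul_apply,
      Pi.smul_apply, h3]
    rfl
  have hlim : Tendsto (fun n => ((b n + M • χ : 𝓔.F) : Lp ℝ (ENNReal.ofReal p) m)) atTop
      (𝓝 w) := by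
    rw [tendsto_iff_norm_sub_tendsto_zero] at hu ⊢
    refine squeeze_zero (fun _ => norm_nonneg _) (fun n => ?_) hu
    refine Lp.norm_le_norm_of_ae_le ?_
    filter_upwards [hval n, hBw, Lp.coeFn_sub ((b n + M • χ : 𝓔.F) : Lp ℝ (ENNReal.ofReal p) m) w,
      Lp.coeFn_sub (u n : Lp ℝ (ENNReal.ofReal p) m) w] with x h1 h2 h3 h4
    rw [h3, h4]
    change ‖𝓔.val (b n + M • χ) x - 𝓔.val w x‖ ≤ ‖𝓔.val (u n) x - 𝓔.val w x‖
    rw [h1]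
    nth_rewrite 1 [← h2]
    exact hBl _ _ _
  have hV0 : ∀ n, 𝓔.Γ (b n + M • χ) V ≤ 0 := fun n => by
    refine (𝓔.Γ_eq_zero_of_continuous _ ⟨⟨fun x => B (f n x) (g x), ?_⟩,
      HasCompactSupport.comp₂_left (m := B) (f n).hasCompactSupport' g.hasCompactSupport' hB0⟩ ?_ hV
      (c := 0) fun x hx => ?_).le
    · have h1 := (f n).continuous
      have h2 := g.continuous
      simp only [hB]
      fun_prop
    · filter_upwards [hval n, huf n] with x h1 h2
      rw [h1, h2]
      rfl
    · change B (f n x) (g x) = 0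
      simp only [hB]
      rw [hgV x hx, mul_one, mul_one, max_eq_right]
      · ring
      · linarith [min_le_right (f n x + M) M]
  have hbd : ∀ n, 𝓔.Γ (b n + M • χ) univ ^ (1 / p) ≤
      (2 ^ p * (𝓔.Γ w univ + 1)) ^ (1 / p) + 𝓔.Γ (M • χ) univ ^ (1 / p) +
        𝓔.Γ ((2 * M) • χ) univ ^ (1 / p) + 𝓔.Γ (M • χ) univ ^ (1 / p) := fun n => by
    have hun : MeasurableSet (univ : Set X) := MeasurableSet.univ
    have hp' : 0 ≤ 1 / p := by positivity
    refine (𝓔.rpow_Γ_add_le hun _ _).trans ?_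
    gcongr
    refine (ENNReal.rpow_le_rpow (hbe n) hp').trans ?_
    refine (𝓔.rpow_Γ_sub_le hun _ _).trans ?_
    gcongr
    refine (ENNReal.rpow_le_rpow (hae n) hp').trans ?_
    refine (𝓔.rpow_Γ_add_le hun _ _).trans ?_
    gcongr
    exact (𝓔.Γ_le_of_sub_le hun w (u n)).trans (by gcongr; exact hu1 n)
  have hfin : ∀ v : 𝓔.F, 𝓔.Γ v univ ^ (1 / p) ≠ ∞ := fun v =>
    ENNReal.rpow_ne_top_of_nonneg (by positivity) (measure_ne_top _ _)
  have h := 𝓔.Γ_le_of_tendsto hV.measurableSet ?_ (fun n => 𝓔.Γ_le_of_rpow_le (hbd n)) hV0 hlim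
  · exact measure_mono_null hKV (nonpos_iff_eq_zero.1 h)
  · refine ENNReal.rpow_ne_top_of_nonneg hp.le ?_
    refine ENNReal.add_ne_top.2 ⟨ENNReal.add_ne_top.2 ⟨ENNReal.add_ne_top.2 ⟨?_, hfin _⟩, hfin _⟩,
      hfin _⟩
    exact ENNReal.rpow_ne_top_of_nonneg (by positivity) (ENNReal.mul_ne_top (two_rpow_ne_top p)
      (ENNReal.add_ne_top.2 ⟨measure_ne_top _ _, by simp⟩))

/-- Boundedness is removed by truncating at `±n`: energies do not increase, the truncations converge
in `L^p` by dominated convergence, and lower semicontinuity concludes. -/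
theorem Γ_isCompact_eq_zero_of_ae_eq_zero [LocallyCompactSpace X] (𝓔 : PEnergyStructure X m p)
    (w : 𝓔.F) {U K : Set X} (hU : IsOpen U) (hw : ∀ᵐ x ∂m, x ∈ U → 𝓔.val w x = 0)
    (hK : IsCompact K) (hKU : K ⊆ U) : 𝓔.Γ w K = 0 := by
  have hp := exponent_pos p
  set φ : ℕ → ℝ → ℝ := fun n t => max (min t n) (-n) with hφ
  have hφl : ∀ n, LipschitzWith 1 (φ n) := fun n => (LipschitzWith.id.min_const _).max_const _
  have hφ0 : ∀ n, φ n 0 = 0 := fun n => by simp [hφ]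
  have hφn : ∀ n t, |φ n t| ≤ n := fun n t => by
    rw [abs_le]
    exact ⟨le_max_right _ _, max_le (min_le_right _ _) (by linarith [n.cast_nonneg (α := ℝ)])⟩
  choose v hv hve using fun n => 𝓔.exists_contraction w (hφl n) (hφ0 n)
  have h0 : ∀ n, 𝓔.Γ (v n) K ≤ 0 := fun n => by
    refine (𝓔.Γ_isCompact_eq_zero_of_bounded (v n) n.cast_nonneg ?_ hU ?_ hK hKU).le
    · filter_upwards [hv n] with x hx
      rw [hx]
      exact hφn n _
    · filter_upwards [hv n, hw] with x hx h2 h3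
      rw [hx, h2 h3, hφ0]
  have hlim : Tendsto (fun n => (v n : Lp ℝ (ENNReal.ofReal p) m)) atTop (𝓝 w) := by
    apply 𝓔.tendsto_Lp_of_lintegral
    have h1 := tendsto_lintegral_of_dominated_convergence (μ := m)
      (F := fun n x => ENNReal.ofReal (|φ n (𝓔.val w x) - 𝓔.val w x| ^ p)) (f := fun _ => 0)
      (fun x => ENNReal.ofReal (|𝓔.val w x| ^ p)) (fun n => ?_) (fun n => ?_)
      (𝓔.lintegral_val_lt_top w).ne ?_
    · rw [lintegral_zero] at h1
      refine h1.congr fun n => lintegral_congr_ae ?_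
      filter_upwards [hv n] with x hx
      rw [hx]
    · have := 𝓔.measurable_val w
      have := (hφl n).continuous.measurable
      fun_prop
    · refine Eventually.of_forall fun x => ENNReal.ofReal_le_ofReal ?_
      refine Real.rpow_le_rpow (abs_nonneg _) ?_ hp.le
      simp only [hφ]
      have := n.cast_nonneg (α := ℝ)
      rcases le_total (𝓔.val w x) n with h | h
      · rw [min_eq_left h]
        rcases le_total (-(n : ℝ)) (𝓔.val w x) with h' | h'
        · rw [max_eq_left h']; simp
        · rw [max_eq_right h', abs_of_nonneg (by linarith), abs_of_nonpos (by linarith)]; linarith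
      · rw [min_eq_right h, max_eq_left (by linarith), abs_of_nonpos (by linarith),
          abs_of_nonneg (by linarith)]
        linarith
    · refine Eventually.of_forall fun x => ?_
      obtain ⟨N, hN⟩ := exists_nat_ge |𝓔.val w x|
      refine tendsto_const_nhds.congr' ?_
      filter_upwards [eventually_ge_atTop N] with n hn
      have h2 := abs_le.1 (hN.trans (Nat.cast_le.2 hn))
      simp only [hφ]
      rw [min_eq_left h2.2, max_eq_left h2.1]
      simp [hp.ne']
  exact nonpos_iff_eq_zero.1
    (𝓔.Γ_le_of_tendsto hK.measurableSet (measure_ne_top (𝓔.Γ w) univ) hve h0 hlim)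

/-- Strong locality: the energy measure does not charge open sets on which the function is
constant. -/
theorem Γ_eq_zero_of_ae_const [SecondCountableTopology X] [LocallyCompactSpace X]
    (𝓔 : PEnergyStructure X m p) (w : 𝓔.F) {U : Set X} (hU : IsOpen U) {c : ℝ}
    (hw : ∀ᵐ x ∂m, x ∈ U → 𝓔.val w x = c) : 𝓔.Γ w U = 0 := by
  have hp := exponent_pos p
  refine 𝓔.Γ_eq_zero_of_isCompact w hU fun K hKU hK => ?_
  obtain ⟨χ, g, V, hχ, hV, hKV, -, -, hgV, -⟩ := 𝓔.exists_cutoff hK hU hKU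
  -- Constants need not belong to the domain, so `c` times a cutoff equal to `1` near `K` is
  -- subtracted instead.
  have h1 : 𝓔.Γ (w - c • χ) K = 0 := by
    refine 𝓔.Γ_isCompact_eq_zero_of_ae_eq_zero _ (hU.inter hV) ?_ hK (subset_inter hKU hKV)
    filter_upwards [hw, hχ, 𝓔.val_sub w (c • χ), 𝓔.val_smul c χ] with x h1 h2 h3 h4 hx
    rw [h3, Pi.sub_apply, h4, Pi.smul_apply, h2, hgV x hx.2, h1 hx.1]
    simp
  have h2 : 𝓔.Γ χ K = 0 :=
    measure_mono_null hKV (𝓔.Γ_eq_zero_of_continuous χ g hχ hV hgV)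
  have h3 := 𝓔.Γ_add_le hK.measurableSet (w - c • χ) (c • χ)
  rw [sub_add_cancel, h1, 𝓔.Γ_smul hK.measurableSet, h2, mul_zero, add_zero, mul_zero] at h3
  exact nonpos_iff_eq_zero.1 h3

theorem Γ_eq_of_sub_eq_zero (𝓔 : PEnergyStructure X m p) {u v : 𝓔.F} {A : Set X}
    (hA : MeasurableSet A) (h : 𝓔.Γ (u - v) A = 0) : 𝓔.Γ u A = 𝓔.Γ v A := by
  have hp := exponent_pos p
  have key : ∀ a b : 𝓔.F, 𝓔.Γ (a - b) A = 0 → 𝓔.Γ a A ≤ 𝓔.Γ b A := fun a b hab => by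
    have h1 := 𝓔.rpow_Γ_add_le hA (a - b) b
    rw [sub_add_cancel, hab, ENNReal.zero_rpow_of_pos (by positivity), zero_add] at h1
    exact (ENNReal.rpow_le_rpow_iff (by positivity)).1 h1
  refine le_antisymm (key u v h) (key v u ?_)
  rwa [← neg_sub, 𝓔.Γ_neg hA]

theorem Γ_eq_of_ae_sub_const [SecondCountableTopology X] [LocallyCompactSpace X]
    (𝓔 : PEnergyStructure X m p) {u v : 𝓔.F} {U A : Set X} (hU : IsOpen U) {c : ℝ}
    (h : ∀ᵐ x ∂m, x ∈ U → 𝓔.val u x - 𝓔.val v x = c) (hA : MeasurableSet A) (hAU : A ⊆ U) :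
    𝓔.Γ u A = 𝓔.Γ v A := by
  refine 𝓔.Γ_eq_of_sub_eq_zero hA (measure_mono_null hAU (𝓔.Γ_eq_zero_of_ae_const _ hU (c := c) ?_))
  filter_upwards [h, 𝓔.val_sub u v] with x h1 h2 hx
  rw [h2]
  exact h1 hx

end PEnergyStructure

/-! ### Volume doubling and nets -/

section Doubling

variable {X : Type*} [MetricSpace X] [MeasurableSpace X] {m : Measure X}

theorem VolumeDoubling.exists_pow (h : VolumeDoubling m) : ∃ c : ℝ≥0, 1 ≤ c ∧
    ∀ (n : ℕ) (x : X) (r : ℝ), 0 < r →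
      m (Metric.ball x (2 ^ n * r)) ≤ (c : ℝ≥0∞) ^ n * m (Metric.ball x r) := by
  obtain ⟨c, hc, h⟩ := h
  refine ⟨c.toNNReal, by simpa using hc, fun n x r hr => ?_⟩
  induction n with
  | zero => simp
  | succ n ih =>
    rw [pow_succ', mul_assoc, pow_succ', mul_assoc]
    refine (h x (2 ^ n * r) (by positivity)).trans ?_
    gcongr
    rfl

theorem VolumeDoubling.ball_lt_top [IsLocallyFiniteMeasure m] (h : VolumeDoubling m) (x : X)
    (r : ℝ) : m (Metric.ball x r) < ∞ := by
  obtain ⟨c, -, h⟩ := h.exists_pow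
  obtain ⟨s, hs, hfin⟩ := m.finiteAt_nhds x
  obtain ⟨r₀, hr₀, hsub⟩ := Metric.mem_nhds_iff.1 hs
  obtain ⟨n, hn⟩ := pow_unbounded_of_one_lt (r / r₀) one_lt_two
  rw [div_lt_iff₀ hr₀] at hn
  calc m (Metric.ball x r) ≤ m (Metric.ball x (2 ^ n * r₀)) :=
        measure_mono (Metric.ball_subset_ball hn.le)
    _ ≤ (c : ℝ≥0∞) ^ n * m (Metric.ball x r₀) := h n x r₀ hr₀
    _ < ∞ := ENNReal.mul_lt_top (by simp) ((measure_mono hsub).trans_lt hfin)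

theorem VolumeDoubling.exists_le (h : VolumeDoubling m) (κ : ℝ) : ∃ c : ℝ≥0, 1 ≤ c ∧
    ∀ (x y : X) (r : ℝ), 0 < r → dist y x < κ * r →
      m (Metric.ball y (κ * r)) ≤ c * m (Metric.ball x r) := by
  obtain ⟨c, hc, h⟩ := h.exists_pow
  obtain ⟨n, hn⟩ := pow_unbounded_of_one_lt (2 * κ) one_lt_two
  refine ⟨c ^ n, one_le_pow₀ hc, fun x y r hr hxy => ?_⟩
  rw [ENNReal.coe_pow]
  refine le_trans (measure_mono (Metric.ball_subset_ball' ?_)) (h n x r hr)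
  nlinarith

/-- Half-radius balls about separated points are disjoint, lie in one ball of comparable radius, and
each carries a fixed fraction of its measure. -/
theorem VolumeDoubling.exists_card_le [OpensMeasurableSpace X] [IsLocallyFiniteMeasure m]
    [m.IsOpenPosMeasure] (h : VolumeDoubling m) {κ : ℝ} (hκ : 0 ≤ κ) : ∃ M : ℕ, ∀ (r : ℝ), 0 < r →
    ∀ T : Finset X, (∀ i ∈ T, ∀ j ∈ T, i ≠ j → r ≤ dist i j) → ∀ x, (∀ i ∈ T, dist i x < κ * r) →
      T.card ≤ M := by
  obtain ⟨c, -, hc⟩ := h.exists_le (2 * (κ + 1))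
  refine ⟨⌈c⌉₊, fun r hr T hT x hx => ?_⟩
  set B := Metric.ball x (2 * (κ + 1) * (r / 2)) with hB
  have hB0 : m B ≠ 0 := (Metric.measure_ball_pos m x (by positivity)).ne'
  have hBt : m B ≠ ∞ := (h.ball_lt_top x _).ne
  have h1 : ∑ i ∈ T, m (Metric.ball i (r / 2)) ≤ m B := by
    rw [← measure_biUnion_finset]
    · refine measure_mono (iUnion₂_subset fun i hi => Metric.ball_subset_ball' ?_)
      linarith [hx i hi]
    · intro i hi j hj hij
      refine Metric.ball_disjoint_ball ?_
      linarith [hT i hi j hj hij]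
    · exact fun i _ => Metric.isOpen_ball.measurableSet
  have h2 : (T.card : ℝ≥0∞) * m B ≤ c * m B := by
    calc (T.card : ℝ≥0∞) * m B = ∑ i ∈ T, m B := by simp
      _ ≤ ∑ i ∈ T, c * m (Metric.ball i (r / 2)) := Finset.sum_le_sum fun i hi =>
          hc i x (r / 2) (by positivity) (by rw [dist_comm]; linarith [hx i hi])
      _ = c * ∑ i ∈ T, m (Metric.ball i (r / 2)) := by rw [Finset.mul_sum]
      _ ≤ c * m B := by gcongr
  have h3 : (T.card : ℝ≥0∞) ≤ c := (ENNReal.mul_le_mul_iff_left hB0 hBt).1 h2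
  have h4 : (T.card : ℝ≥0) ≤ c := by exact_mod_cast h3
  exact_mod_cast h4.trans (Nat.le_ceil c)

/-- A maximal `r`-separated set. -/
structure IsNet (S : Set X) (r : ℝ) : Prop where
  separated : ∀ i ∈ S, ∀ j ∈ S, i ≠ j → r ≤ dist i j
  cover : ∀ x, ∃ i ∈ S, dist x i < r

theorem exists_isNet {X : Type*} [MetricSpace X] {r : ℝ} (hr : 0 < r) : ∃ S : Set X, IsNet S r := by
  obtain ⟨S, hS⟩ := zorn_subset {S : Set X | ∀ i ∈ S, ∀ j ∈ S, i ≠ j → r ≤ dist i j} (by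
    intro c hc hch
    refine ⟨⋃₀ c, ?_, fun s hs => subset_sUnion_of_mem hs⟩
    rintro i ⟨s, hs, his⟩ j ⟨t, ht, hjt⟩ hij
    rcases hch.total hs ht with hst | hst
    · exact hc ht i (hst his) j hjt hij
    · exact hc hs i his j (hst hjt) hij)
  refine ⟨S, hS.prop, fun x => ?_⟩
  by_contra! hx
  have hins : insert x S ∈ {S : Set X | ∀ i ∈ S, ∀ j ∈ S, i ≠ j → r ≤ dist i j} := by
    rintro i (rfl | hi) j (rfl | hj) hij
    · exact absurd rfl hij
    · exact hx j hj
    · rw [dist_comm]; exact hx i hi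
    · exact hS.prop i hi j hj hij
  have hxS : x ∈ S := hS.le_of_ge hins (subset_insert x S) (mem_insert x S)
  have := hx x hxS
  rw [dist_self] at this
  linarith

theorem IsNet.finite_inter_ball [OpensMeasurableSpace X] [IsLocallyFiniteMeasure m]
    [m.IsOpenPosMeasure] (h : VolumeDoubling m) {S : Set X} {r : ℝ} (hr : 0 < r) (hS : IsNet S r)
    (x : X) (R : ℝ) : (S ∩ Metric.ball x R).Finite := by
  obtain ⟨M, hM⟩ := h.exists_card_le (κ := max (R / r) 0) (le_max_right _ _)
  by_contra hinf
  obtain ⟨T, hTs, hTc⟩ := Set.Infinite.exists_subset_card_eq hinf (M + 1)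
  have := hM r hr T (fun i hi j hj => hS.separated i (hTs hi).1 j (hTs hj).1) x (fun i hi => by
    have h1 : dist i x < R := (hTs hi).2
    have h2 : R / r * r ≤ max (R / r) 0 * r := by gcongr; exact le_max_left _ _
    rw [div_mul_cancel₀ _ hr.ne'] at h2
    linarith)
  omega

theorem IsNet.countable [OpensMeasurableSpace X] [IsLocallyFiniteMeasure m]
    [m.IsOpenPosMeasure] (h : VolumeDoubling m) {S : Set X} {r : ℝ} (hr : 0 < r)
    (hS : IsNet S r) : S.Countable := by
  rcases S.eq_empty_or_nonempty with rfl | ⟨o, -⟩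
  · exact countable_empty
  have : S = ⋃ n : ℕ, S ∩ Metric.ball o n := by
    rw [← inter_iUnion, Metric.iUnion_ball_nat, inter_univ]
  rw [this]
  exact countable_iUnion fun n => (hS.finite_inter_ball h hr o n).countable

/-- A bounded set meets only finitely many balls of a net, so closed balls are totally bounded, and
they are complete. -/
theorem VolumeDoubling.properSpace [OpensMeasurableSpace X] [IsLocallyFiniteMeasure m]
    [m.IsOpenPosMeasure] [CompleteSpace X] (h : VolumeDoubling m) : ProperSpace X := by
  refine ⟨fun x R => ?_⟩
  refine isCompact_iff_totallyBounded_isComplete.2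
    ⟨?_, Metric.isClosed_closedBall.isComplete⟩
  refine Metric.totallyBounded_iff.2 fun ε hε => ?_
  obtain ⟨S, hS⟩ := exists_isNet (X := X) hε
  refine ⟨S ∩ Metric.ball x (R + ε), hS.finite_inter_ball h hε x _, fun y hy => ?_⟩
  obtain ⟨i, hi, hyi⟩ := hS.cover y
  refine mem_iUnion₂.2 ⟨i, ⟨hi, ?_⟩, hyi⟩
  rw [Metric.mem_closedBall] at hy
  rw [Metric.mem_ball]
  linarith [dist_triangle_left i x y]

/-- Bounded overlap: each point lies in at most `M` of the enlarged balls. The measure is arbitrary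
because this is used both for energy measures and for densities with respect to `m`. -/
theorem VolumeDoubling.exists_tsum_le [OpensMeasurableSpace X] [IsLocallyFiniteMeasure m]
    [m.IsOpenPosMeasure] (h : VolumeDoubling m) {κ : ℝ} (hκ : 0 ≤ κ) : ∃ M : ℕ, ∀ (r : ℝ), 0 < r →
    ∀ S : Set X, IsNet S r → ∀ S' ⊆ S, ∀ μ : Measure X,
      ∑' i : S', μ (Metric.ball (i : X) (κ * r)) ≤ M * μ (⋃ i ∈ S', Metric.ball i (κ * r)) := by
  obtain ⟨M, hM⟩ := h.exists_card_le hκ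
  refine ⟨M, fun r hr S hS S' hS' μ => ?_⟩
  have hcount : Countable S' := ((hS.countable h hr).mono hS').to_subtype
  set U := ⋃ i ∈ S', Metric.ball i (κ * r) with hU
  have hUo : IsOpen U := isOpen_biUnion fun i _ => Metric.isOpen_ball
  calc ∑' i : S', μ (Metric.ball (i : X) (κ * r))
      = ∑' i : S', ∫⁻ x, (Metric.ball (i : X) (κ * r)).indicator 1 x ∂μ := by
        congr 1; ext i; rw [lintegral_indicator_one Metric.isOpen_ball.measurableSet]
    _ = ∫⁻ x, ∑' i : S', (Metric.ball (i : X) (κ * r)).indicator 1 x ∂μ :=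
        (lintegral_tsum fun i => (measurable_one.indicator
          Metric.isOpen_ball.measurableSet).aemeasurable).symm
    _ ≤ ∫⁻ x, M * U.indicator 1 x ∂μ := by
        refine lintegral_mono fun x => ?_
        rw [ENNReal.tsum_eq_iSup_sum]
        refine iSup_le fun T => ?_
        classical
        set T' := T.filter fun i : S' => x ∈ Metric.ball (i : X) (κ * r) with hT'
        have h1 : ∑ i ∈ T, (Metric.ball (i : X) (κ * r)).indicator (1 : X → ℝ≥0∞) x = T'.card := by
          simp [indicator_apply, hT']
        rw [h1]
        by_cases hx : x ∈ U
        · rw [indicator_of_mem hx, Pi.one_apply, mul_one]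
          have h2 := hM r hr (T'.image Subtype.val) (by
            intro i hi j hj
            obtain ⟨i, -, rfl⟩ := Finset.mem_image.1 hi
            obtain ⟨j, -, rfl⟩ := Finset.mem_image.1 hj
            exact hS.separated _ (hS' i.2) _ (hS' j.2)) x (by
            intro i hi
            obtain ⟨i, hi', rfl⟩ := Finset.mem_image.1 hi
            have h3 := (Finset.mem_filter.1 hi').2
            rwa [Metric.mem_ball, dist_comm] at h3)
          rw [Finset.card_image_of_injective _ Subtype.val_injective] at h2
          exact_mod_cast h2
        · have : T' = ∅ := by
            refine Finset.filter_eq_empty_iff.2 fun i _ hi => hx ?_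
            exact mem_iUnion₂.2 ⟨i, i.2, hi⟩
          simp [this]
    _ = M * μ U := by
        rw [lintegral_const_mul _ (measurable_one.indicator hUo.measurableSet),
          lintegral_indicator_one hUo.measurableSet]

end Doubling

theorem ENNReal.inv_le_mul_inv_of_le_mul {a b t : ℝ≥0∞} (h : a ≤ t * b) (h0 : a ≠ 0)
    (h1 : a ≠ ∞) : b⁻¹ ≤ t * a⁻¹ :=
  calc b⁻¹ = a * a⁻¹ * b⁻¹ := by rw [ENNReal.mul_inv_cancel h0 h1, one_mul]
    _ ≤ t * b * a⁻¹ * b⁻¹ := by gcongr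
    _ = t * a⁻¹ * (b * b⁻¹) := by ring
    _ ≤ t * a⁻¹ * 1 := by gcongr; exact ENNReal.mul_inv_le_one b
    _ = t * a⁻¹ := mul_one _

/-! ### Scale functions -/

namespace IsScaleFunction

variable {Ψ : ℝ → ℝ}

theorem pos (h : IsScaleFunction Ψ) {r : ℝ} (hr : 0 < r) : 0 < Ψ r := h.bijOn.mapsTo hr

theorem le (h : IsScaleFunction Ψ) {r R : ℝ} (hr : 0 < r) (hrR : r ≤ R) : Ψ r ≤ Ψ R :=
  (h.strictMonoOn.le_iff_le hr (hr.trans_le hrR)).2 hrR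

theorem exists_le_mul (h : IsScaleFunction Ψ) {k : ℝ} (hk : 1 ≤ k) : ∃ C : ℝ≥0,
    ∀ r : ℝ, 0 < r → ENNReal.ofReal (Ψ (k * r)) ≤ C * ENNReal.ofReal (Ψ r) := by
  obtain ⟨C, b₁, b₂, hC, -, -, hb⟩ := h.bounds
  refine ⟨(C * k ^ b₂).toNNReal, fun r hr => ?_⟩
  have h1 := (hb r (k * r) hr (le_mul_of_one_le_left hr.le hk)).2
  rw [mul_div_cancel_right₀ _ hr.ne', div_le_iff₀ (h.pos hr)] at h1
  have : 0 ≤ C * k ^ b₂ := by positivity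
  refine (ENNReal.ofReal_le_ofReal h1).trans_eq ?_
  rw [ENNReal.ofReal_mul this]
  rfl

theorem tendsto_zero (h : IsScaleFunction Ψ) :
    Tendsto (fun r => ENNReal.ofReal (Ψ r)) (𝓝[>] 0) (𝓝 0) := by
  have : Tendsto Ψ (𝓝[>] 0) (𝓝 0) := by
    refine tendsto_order.2 ⟨fun a ha => ?_, fun a ha => ?_⟩
    · filter_upwards [self_mem_nhdsWithin] with r hr
      exact ha.trans (h.pos hr)
    · obtain ⟨s, hs, rfl⟩ := h.bijOn.surjOn ha
      filter_upwards [Ioo_mem_nhdsGT hs] with r hr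
      exact h.strictMonoOn hr.1 hs hr.2
  simpa using ENNReal.tendsto_ofReal this

end IsScaleFunction

/-! ### Mean oscillations -/

/-- The mean of `|u - u(y)| ^ p` over the ball `B(y, s)`. -/
def meanOsc {X : Type*} [MetricSpace X] [MeasurableSpace X] (m : Measure X) (p : ℝ) (u : X → ℝ)
    (s : ℝ) (y : X) : ℝ≥0∞ :=
  (m (Metric.ball y s))⁻¹ * ∫⁻ x in Metric.ball y s, ENNReal.ofReal (|u x - u y| ^ p) ∂m

section MeanOsc

variable {X : Type*} [MetricSpace X] [MeasurableSpace X] [BorelSpace X]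
  {m : Measure X} {p : ℝ}

theorem measurable_lintegral_ball [SecondCountableTopology X] [SFinite m] {f : X → X → ℝ≥0∞}
    (hf : Measurable (Function.uncurry f)) (s : ℝ) :
    Measurable fun y => ∫⁻ x in Metric.ball y s, f y x ∂m := by
  have hS : MeasurableSet {z : X × X | dist z.2 z.1 < s} :=
    (isOpen_lt (by fun_prop) continuous_const).measurableSet
  have := (hf.indicator hS).lintegral_prod_right' (ν := m)
  convert! this using 2 with y
  rw [← lintegral_indicator Metric.isOpen_ball.measurableSet]
  rfl

theorem measurable_measure_ball [SecondCountableTopology X] [SFinite m] (s : ℝ) :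
    Measurable fun y => m (Metric.ball y s) := by
  simpa using measurable_lintegral_ball (m := m) (f := fun _ _ => 1) measurable_const s

theorem measurable_meanOsc [SecondCountableTopology X] [SFinite m] {u : X → ℝ}
    (hu : Measurable u) (s : ℝ) : Measurable (meanOsc m p u s) := by
  refine (measurable_measure_ball s).inv.mul (measurable_lintegral_ball ?_ s)
  have h1 : Measurable fun z : X × X => u z.2 - u z.1 :=
    (hu.comp measurable_snd).sub (hu.comp measurable_fst)
  have h2 : Measurable fun z : X × X => |u z.2 - u z.1| ^ p := h1.abs.pow_const p
  exact h2.ennreal_ofReal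

theorem ofReal_abs_sub_rpow_le (hp : 0 ≤ p) (a b c : ℝ) : ENNReal.ofReal (|a - b| ^ p) ≤
    2 ^ p * (ENNReal.ofReal (|a - c| ^ p) + ENNReal.ofReal (|b - c| ^ p)) := by
  have key : ∀ s t : ℝ, 0 ≤ s → 0 ≤ t → |a - b| ≤ s + t → s ≤ t →
      ENNReal.ofReal (|a - b| ^ p) ≤ 2 ^ p * ENNReal.ofReal (t ^ p) := fun s t hs ht h hst => by
    have h1 : |a - b| ^ p ≤ (2 * t) ^ p :=
      Real.rpow_le_rpow (abs_nonneg _) (by linarith) hp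
    refine (ENNReal.ofReal_le_ofReal h1).trans_eq ?_
    rw [Real.mul_rpow (by norm_num) ht, ENNReal.ofReal_mul (by positivity),
      ← ENNReal.ofReal_rpow_of_nonneg (x := 2) (by norm_num) hp, ENNReal.ofReal_ofNat]
  have h0 : |a - b| ≤ |a - c| + |b - c| := by
    rw [abs_sub_comm b c]
    exact abs_sub_le a c b
  rcases le_total |a - c| |b - c| with h | h
  · exact (key _ _ (abs_nonneg _) (abs_nonneg _) h0 h).trans (by gcongr; exact le_add_self)
  · exact (key _ _ (abs_nonneg _) (abs_nonneg _) (by linarith) h).trans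
      (by gcongr; exact le_self_add)

theorem lintegral_lintegral_abs_sub_le {X : Type*} [MeasurableSpace X] {m : Measure X} {p : ℝ}
    (hp : 0 ≤ p) {u : X → ℝ} (hu : Measurable u) (B : Set X)
    (c : ℝ) :
    ∫⁻ y in B, ∫⁻ x in B, ENNReal.ofReal (|u x - u y| ^ p) ∂m ∂m ≤
      2 ^ p * (2 * (m B * ∫⁻ x in B, ENNReal.ofReal (|u x - c| ^ p) ∂m)) := by
  have hf : Measurable fun x => ENNReal.ofReal (|u x - c| ^ p) := by fun_prop
  calc _ ≤ ∫⁻ y in B, ∫⁻ x in B, 2 ^ p * (ENNReal.ofReal (|u x - c| ^ p) +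
        ENNReal.ofReal (|u y - c| ^ p)) ∂m ∂m :=
        lintegral_mono fun y => lintegral_mono fun x => ofReal_abs_sub_rpow_le hp _ _ _
    _ = 2 ^ p * ∫⁻ y in B, (∫⁻ x in B, ENNReal.ofReal (|u x - c| ^ p) ∂m +
        ENNReal.ofReal (|u y - c| ^ p) * m B) ∂m := by
        have hg : Measurable fun y => (∫⁻ x in B, ENNReal.ofReal (|u x - c| ^ p) ∂m) +
          ENNReal.ofReal (|u y - c| ^ p) * m B := measurable_const.add (hf.mul_const _)
        rw [← lintegral_const_mul _ hg]
        refine lintegral_congr fun y => ?_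
        rw [lintegral_const_mul _ (hf.add_const _), lintegral_add_left hf, setLIntegral_const]
    _ = _ := by
        rw [lintegral_add_left measurable_const, setLIntegral_const, lintegral_mul_const _ hf]
        ring

end MeanOsc

namespace PEnergyStructure

variable {X : Type*} [MetricSpace X] [MeasurableSpace X] [BorelSpace X]
  {m : Measure X} {p : ℝ} [Fact (1 < p)]

/-! ### Connectedness and reverse volume doubling -/

/-- If the sphere were empty, the ball would be compact and open, and its indicator would be a
cutoff in the domain. Locality gives it zero energy on both pieces, so it would be constant. -/
theorem exists_dist_eq [ProperSpace X] [m.IsOpenPosMeasure] (𝓔 : PEnergyStructure X m p)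
    {y z : X} {s : ℝ} (hs : 0 < s) (hz : s ≤ dist y z) : ∃ z, dist y z = s := by
  by_contra! h
  have hball : Metric.closedBall y s = Metric.ball y s := by
    refine subset_antisymm (fun x hx => ?_) Metric.ball_subset_closedBall
    rw [Metric.mem_closedBall, dist_comm] at hx
    rw [Metric.mem_ball, dist_comm]
    exact lt_of_le_of_ne hx (h x)
  obtain ⟨χ, g, V, hχ, hV, hKV, -, -, hgV, hgU⟩ := 𝓔.exists_cutoff
    (isCompact_closedBall y s) Metric.isOpen_ball hball.subset
  have hc : IsOpen (Metric.ball y s)ᶜ := by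
    rw [← hball]
    exact Metric.isClosed_closedBall.isOpen_compl
  have h1 : 𝓔.Γ χ (Metric.ball y s) = 0 := 𝓔.Γ_eq_zero_of_continuous χ g hχ Metric.isOpen_ball
    fun x hx => hgV x (hKV (Metric.ball_subset_closedBall hx))
  have h2 : 𝓔.Γ χ (Metric.ball y s)ᶜ = 0 := 𝓔.Γ_eq_zero_of_continuous χ g hχ hc hgU
  have h3 : 𝓔.E χ = 0 := by
    rw [𝓔.energy_eq, measureReal_def, ← union_compl_self (Metric.ball y s), measure_union_null h1 h2]
    rfl
  obtain ⟨c, hcχ⟩ := 𝓔.const_of_energy_zero χ h3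
  have h4 : ∀ᵐ x ∂m, g x = c := by
    filter_upwards [hχ, hcχ] with x h5 h6
    rw [← h5, h6]
  have key : ∀ U : Set X, IsOpen U → U.Nonempty → ∃ x ∈ U, g x = c := fun U hU hne => by
    by_contra! h5
    have : m U = 0 := measure_mono_null (fun x hx => h5 x hx) (ae_iff.1 h4)
    exact (hU.measure_pos m hne).ne' this
  obtain ⟨a, ha, hac⟩ := key _ Metric.isOpen_ball ⟨y, Metric.mem_ball_self hs⟩
  obtain ⟨b, hb, hbc⟩ := key _ hc ⟨z, by simpa [dist_comm] using hz⟩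
  rw [hgV a (hKV (Metric.ball_subset_closedBall ha))] at hac
  rw [hgU b hb] at hbc
  linarith

/-- A point `z` at distance exactly `r/8` from `y` gives two disjoint balls of radius `r/16` inside
`B(y,r)` with comparable measures, so the one about `y` misses a definite proportion. The distance
assumption excludes radii too large for the space. -/
theorem exists_reverse_doubling [ProperSpace X] [m.IsOpenPosMeasure] [IsLocallyFiniteMeasure m]
    (𝓔 : PEnergyStructure X m p) (hVD : VolumeDoubling m) : ∃ θ : ℝ≥0, θ < 1 ∧
    ∀ (y : X) (r : ℝ), 0 < r → (∃ z, r / 8 ≤ dist y z) →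
      m (Metric.ball y (r / 16)) ≤ θ * m (Metric.ball y r) := by
  obtain ⟨c, -, hc⟩ := hVD.exists_le 3
  refine ⟨c / (1 + c), (div_lt_one (by positivity)).2 (by simp), fun y r hr ⟨z₀, hz₀⟩ => ?_⟩
  obtain ⟨z, hz⟩ := 𝓔.exists_dist_eq (by positivity) hz₀
  set a := m (Metric.ball y (r / 16))
  set b := m (Metric.ball z (r / 16))
  set t := m (Metric.ball y r)
  have h1 : a ≤ c * b := (measure_mono (Metric.ball_subset_ball (by linarith))).trans
    (hc z y (r / 16) (by positivity) (by linarith))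
  have h2 : a + b ≤ t := by
    rw [← measure_union (Metric.ball_disjoint_ball (by linarith)) Metric.isOpen_ball.measurableSet]
    refine measure_mono (union_subset (Metric.ball_subset_ball (by linarith))
      (Metric.ball_subset_ball' ?_))
    rw [dist_comm]
    linarith
  have h3 : (1 + c) * a ≤ c * t := by
    calc (1 + c) * a = a + c * a := by ring
      _ ≤ c * b + c * a := by gcongr
      _ = c * (a + b) := by ring
      _ ≤ c * t := by gcongr
  rw [ENNReal.coe_div (by positivity), ENNReal.coe_add, ENNReal.coe_one, ENNReal.div_eq_inv_mul,
    mul_assoc, ← ENNReal.div_eq_inv_mul, ENNReal.le_div_iff_mul_le (by simp) (by simp), mul_comm]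
  exact h3

theorem _root_.measure_ball_div_pow_le {X : Type*} [MetricSpace X] [MeasurableSpace X]
    {m : Measure X} {θ : ℝ≥0}
    (h : ∀ (y : X) (r : ℝ), 0 < r → (∃ z, r / 8 ≤ dist y z) →
      m (Metric.ball y (r / 16)) ≤ θ * m (Metric.ball y r)) {y : X} {r : ℝ} (hr : 0 < r)
    (hz : ∃ z, r / 8 ≤ dist y z) (k : ℕ) :
    m (Metric.ball y (r / 16 ^ k)) ≤ (θ : ℝ≥0∞) ^ k * m (Metric.ball y r) := by
  induction k with
  | zero => simp
  | succ k ih =>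
    obtain ⟨z, hz⟩ := hz
    have h1 : r / 16 ^ k ≤ r := div_le_self hr.le (one_le_pow₀ (by norm_num))
    have h2 := h y (r / 16 ^ k) (by positivity) ⟨z, by linarith⟩
    rw [pow_succ, ← div_div, pow_succ', mul_assoc]
    exact h2.trans (by gcongr)

/-! ### Upper bounds from the Poincaré inequality -/

/-- For `y` in a net ball `B(i,s)`, the ball `B(y,s)` lies in `B(i,2s)` with comparable measure.
Poincaré on `B(i,2s)` bounds the oscillation there, and the enlarged balls overlap boundedly. Only
net balls meeting `D` are used, which keeps the energy localized near `D`. -/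
theorem exists_lintegral_meanOsc_le [IsLocallyFiniteMeasure m] [m.IsOpenPosMeasure]
    (𝓔 : PEnergyStructure X m p) {Ψ : ℝ → ℝ} (hΨ : IsScaleFunction Ψ)
    (hVD : VolumeDoubling m) (hPI : 𝓔.PoincareInequality Ψ) :
    ∃ (C : ℝ≥0) (κ : ℝ), 0 < κ ∧ ∀ (u : 𝓔.F) (s : ℝ), 0 < s → ∀ D : Set X,
      ∫⁻ y in D, meanOsc m p (𝓔.val u) s y ∂m ≤
        C * ENNReal.ofReal (Ψ s) * 𝓔.Γ u (Metric.thickening (κ * s) D) := by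
  have hp := exponent_pos p
  obtain ⟨C, A, hC, hA, hPI⟩ := hPI
  obtain ⟨c, -, hc⟩ := hVD.exists_le 2
  obtain ⟨M, hM⟩ := hVD.exists_tsum_le (κ := A * 2) (by positivity)
  obtain ⟨CΨ, hCΨ⟩ := hΨ.exists_le_mul one_le_two
  refine ⟨c * 2 ^ p * 2 * C.toNNReal * CΨ * M, 2 * A + 1, by positivity, fun u s hs D => ?_⟩
  obtain ⟨S, hS⟩ := exists_isNet (X := X) hs
  set S' : Set X := {i ∈ S | (Metric.ball i s ∩ D).Nonempty} with hS'
  have hS'S : S' ⊆ S := fun i hi => hi.1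
  have hcount : Countable S' := ((hS.countable hVD hs).mono hS'S).to_subtype
  set U := ⋃ i ∈ S', Metric.ball i (A * 2 * s) with hU
  have hcover : D ⊆ ⋃ i : S', Metric.ball (i : X) s := fun y hy => by
    obtain ⟨i, hi, hyi⟩ := hS.cover y
    exact mem_iUnion.2 ⟨⟨i, hi, y, hyi, hy⟩, hyi⟩
  have hUD : U ⊆ Metric.thickening ((2 * A + 1) * s) D := by
    refine iUnion₂_subset fun i hi z hz => ?_
    obtain ⟨-, d, hd, hdD⟩ := hi
    refine Metric.mem_thickening_iff.2 ⟨d, hdD, ?_⟩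
    rw [Metric.mem_ball] at hz hd
    linarith [dist_triangle_right z d i]
  have hball : ∀ i : X, ∫⁻ y in Metric.ball i s, meanOsc m p (𝓔.val u) s y ∂m ≤
      c * 2 ^ p * 2 * C.toNNReal * CΨ * ENNReal.ofReal (Ψ s) *
        𝓔.Γ u (Metric.ball i (A * 2 * s)) := fun i => by
    set B := Metric.ball i (2 * s) with hB
    have hB0 : m B ≠ 0 := (Metric.measure_ball_pos m i (by positivity)).ne'
    have hBt : m B ≠ ∞ := (hVD.ball_lt_top i _).ne
    set a := ⨍ z in B, 𝓔.val u z ∂m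
    calc ∫⁻ y in Metric.ball i s, meanOsc m p (𝓔.val u) s y ∂m
        ≤ ∫⁻ y in Metric.ball i s, c * (m B)⁻¹ *
            ∫⁻ x in B, ENNReal.ofReal (|𝓔.val u x - 𝓔.val u y| ^ p) ∂m ∂m := by
          refine setLIntegral_mono' Metric.isOpen_ball.measurableSet fun y hy => ?_
          rw [Metric.mem_ball] at hy
          refine mul_le_mul' ?_ (lintegral_mono_set (Metric.ball_subset_ball' (by linarith)))
          refine ENNReal.inv_le_mul_inv_of_le_mul (hc y i s hs ?_) hB0 hBt
          rw [dist_comm]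
          linarith
      _ ≤ ∫⁻ y in B, c * (m B)⁻¹ *
            ∫⁻ x in B, ENNReal.ofReal (|𝓔.val u x - 𝓔.val u y| ^ p) ∂m ∂m :=
          lintegral_mono_set (Metric.ball_subset_ball (by linarith))
      _ = c * (m B)⁻¹ * ∫⁻ y in B,
            ∫⁻ x in B, ENNReal.ofReal (|𝓔.val u x - 𝓔.val u y| ^ p) ∂m ∂m :=
          lintegral_const_mul' _ _ (ENNReal.mul_ne_top (by simp) (by simpa using hB0))
      _ ≤ c * (m B)⁻¹ * (2 ^ p * (2 * (m B *
            ∫⁻ x in B, ENNReal.ofReal (|𝓔.val u x - a| ^ p) ∂m))) := by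
          gcongr
          exact lintegral_lintegral_abs_sub_le hp.le (𝓔.measurable_val u) B a
      _ = c * 2 ^ p * 2 * ((m B)⁻¹ * m B) *
            ∫⁻ x in B, ENNReal.ofReal (|𝓔.val u x - a| ^ p) ∂m := by ring
      _ ≤ c * 2 ^ p * 2 * 1 * (ENNReal.ofReal (C * Ψ (2 * s)) *
            𝓔.Γ u (Metric.ball i (A * (2 * s)))) := by
          gcongr
          · exact ENNReal.inv_mul_le_one _
          · exact hPI i (2 * s) (by positivity) u
      _ = c * 2 ^ p * 2 * C.toNNReal * ENNReal.ofReal (Ψ (2 * s)) *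
            𝓔.Γ u (Metric.ball i (A * 2 * s)) := by
          rw [ENNReal.ofReal_mul hC.le, ← mul_assoc A, ENNReal.ofReal]
          ring
      _ ≤ c * 2 ^ p * 2 * C.toNNReal * (CΨ * ENNReal.ofReal (Ψ s)) *
            𝓔.Γ u (Metric.ball i (A * 2 * s)) := by
          gcongr
          exact hCΨ s hs
      _ = _ := by ring
  calc ∫⁻ y in D, meanOsc m p (𝓔.val u) s y ∂m
      ≤ ∫⁻ y in ⋃ i : S', Metric.ball (i : X) s, meanOsc m p (𝓔.val u) s y ∂m :=
        lintegral_mono_set hcover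
    _ ≤ ∑' i : S', ∫⁻ y in Metric.ball (i : X) s, meanOsc m p (𝓔.val u) s y ∂m :=
        lintegral_iUnion_le _ _
    _ ≤ ∑' i : S', c * 2 ^ p * 2 * C.toNNReal * CΨ * ENNReal.ofReal (Ψ s) *
        𝓔.Γ u (Metric.ball (i : X) (A * 2 * s)) := ENNReal.tsum_le_tsum fun i => hball i
    _ ≤ c * 2 ^ p * 2 * C.toNNReal * CΨ * ENNReal.ofReal (Ψ s) * (M * 𝓔.Γ u U) := by
        rw [ENNReal.tsum_mul_left]
        gcongr
        exact hM s hs S hS S' hS'S (𝓔.Γ u)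
    _ ≤ c * 2 ^ p * 2 * C.toNNReal * CΨ * ENNReal.ofReal (Ψ s) *
        (M * 𝓔.Γ u (Metric.thickening ((2 * A + 1) * s) D)) := by gcongr
    _ = _ := by
        push_cast
        rw [ENNReal.coe_rpow_of_nonneg _ hp.le]
        push_cast
        ring

/-- The Korevaar-Schoen energy with weight `1 / Ψ(d(x, y))`, localized to `y ∈ D`. -/
theorem exists_lintegral_dist_le [SecondCountableTopology X] [ProperSpace X]
    [IsLocallyFiniteMeasure m] [m.IsOpenPosMeasure]
    (𝓔 : PEnergyStructure X m p) {Ψ : ℝ → ℝ} (hΨ : IsScaleFunction Ψ)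
    (hVD : VolumeDoubling m) (hPI : 𝓔.PoincareInequality Ψ) :
    ∃ (C : ℝ≥0) (κ : ℝ), 0 < κ ∧ ∀ (u : 𝓔.F) (r : ℝ), 0 < r → (∀ y : X, ∃ z, r / 8 ≤ dist y z) →
      ∀ D : Set X, ∫⁻ y in D, (m (Metric.ball y r))⁻¹ * ∫⁻ x in Metric.ball y r,
        ENNReal.ofReal (|𝓔.val u x - 𝓔.val u y| ^ p / Ψ (dist x y)) ∂m ∂m ≤
        C * 𝓔.Γ u (Metric.thickening (κ * r) D) := by
  have hp := exponent_pos p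
  obtain ⟨C, κ, hκ, hC⟩ := 𝓔.exists_lintegral_meanOsc_le hΨ hVD hPI
  obtain ⟨θ, hθ1, hθ⟩ := 𝓔.exists_reverse_doubling hVD
  obtain ⟨C₂, hC₂⟩ := hΨ.exists_le_mul (k := 16) (by norm_num)
  refine ⟨(1 - θ)⁻¹ * (C₂ * C), κ, hκ, fun u r hr hz D => ?_⟩
  set v := 𝓔.val u with hv
  have hvm : Measurable v := 𝓔.measurable_val u
  have hrk : ∀ k : ℕ, 0 < r / 16 ^ k := fun k => by positivity
  set w : ℕ → ℝ≥0∞ := fun k => (ENNReal.ofReal (Ψ (r / 16 ^ (k + 1))))⁻¹ with hw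
  have hgm : ∀ y, Measurable fun x => ENNReal.ofReal (|v x - v y| ^ p) := fun y => by fun_prop
  -- The least `n` with `r/16^n ≤ d(x,y)` is some `k+1`, and the `k`-th term alone dominates. Its
  -- indicator is that of the whole ball `B(y, r/16^k)`, so that a mean oscillation appears.
  have hpt : ∀ x y, x ∈ Metric.ball y r →
      ENNReal.ofReal (|v x - v y| ^ p / Ψ (dist x y)) ≤
        ∑' k : ℕ, (Metric.ball y (r / 16 ^ k)).indicator
          (fun x => w k * ENNReal.ofReal (|v x - v y| ^ p)) x := fun x y hx => by
    obtain rfl | hxy := eq_or_ne x y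
    · simp [hp.ne']
    have hd : 0 < dist x y := dist_pos.2 hxy
    have hex : ∃ n : ℕ, r / 16 ^ n ≤ dist x y := by
      obtain ⟨n, hn⟩ := pow_unbounded_of_one_lt (r / dist x y) (by norm_num : (1 : ℝ) < 16)
      refine ⟨n, ?_⟩
      rw [div_lt_iff₀ hd] at hn
      rw [div_le_iff₀ (by positivity)]
      linarith
    classical
    obtain ⟨k, hk⟩ : ∃ k, Nat.find hex = k + 1 := by
      refine Nat.exists_eq_succ_of_ne_zero fun h0 => ?_
      have := Nat.find_spec hex
      rw [h0, pow_zero, div_one] at this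
      exact absurd (Metric.mem_ball.1 hx) (not_lt.2 this)
    have hk1 : r / 16 ^ (k + 1) ≤ dist x y := hk ▸ Nat.find_spec hex
    have hk2 : dist x y < r / 16 ^ k := not_le.1 (Nat.find_min hex (hk ▸ Nat.lt_succ_self k))
    refine le_trans ?_ (ENNReal.le_tsum k)
    rw [indicator_of_mem (Metric.mem_ball.2 hk2), ENNReal.ofReal_div_of_pos (hΨ.pos hd),
      ENNReal.div_eq_inv_mul]
    gcongr
    exact ENNReal.inv_le_inv.2 (ENNReal.ofReal_le_ofReal (hΨ.le (hrk _) hk1))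
  have hinner : ∀ y, (m (Metric.ball y r))⁻¹ * ∫⁻ x in Metric.ball y r,
      ENNReal.ofReal (|v x - v y| ^ p / Ψ (dist x y)) ∂m ≤
        ∑' k : ℕ, (θ : ℝ≥0∞) ^ k * w k * meanOsc m p v (r / 16 ^ k) y := fun y => by
    calc _ ≤ (m (Metric.ball y r))⁻¹ * ∫⁻ x, ∑' k : ℕ, (Metric.ball y (r / 16 ^ k)).indicator
          (fun x => w k * ENNReal.ofReal (|v x - v y| ^ p)) x ∂m := by
          refine mul_le_mul' le_rfl ?_
          exact (setLIntegral_mono' Metric.isOpen_ball.measurableSet fun x hx => hpt x y hx).trans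
            (setLIntegral_le_lintegral _ _)
      _ = ∑' k : ℕ, (m (Metric.ball y r))⁻¹ * (w k * ∫⁻ x in Metric.ball y (r / 16 ^ k),
          ENNReal.ofReal (|v x - v y| ^ p) ∂m) := by
          rw [lintegral_tsum fun k => (((hgm y).const_mul _).indicator
            Metric.isOpen_ball.measurableSet).aemeasurable, ENNReal.tsum_mul_left]
          congr 1
          refine tsum_congr fun k => ?_
          rw [lintegral_indicator Metric.isOpen_ball.measurableSet, lintegral_const_mul _ (hgm y)]
      _ ≤ _ := by
          refine ENNReal.tsum_le_tsum fun k => ?_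
          -- Replacing `1/m(B(y,r))` by `1/m(B(y,r/16^k))` gains the factor `θ^k` that makes the
          -- series summable.
          have h1 := ENNReal.inv_le_mul_inv_of_le_mul (measure_ball_div_pow_le hθ hr (hz y) k)
            (Metric.measure_ball_pos m y (hrk k)).ne' (hVD.ball_lt_top y _).ne
          calc _ ≤ θ ^ k * (m (Metric.ball y (r / 16 ^ k)))⁻¹ *
                (w k * ∫⁻ x in Metric.ball y (r / 16 ^ k),
                  ENNReal.ofReal (|v x - v y| ^ p) ∂m) := by gcongr
            _ = _ := by rw [meanOsc]; ring
  have hwC : ∀ k, w k * ENNReal.ofReal (Ψ (r / 16 ^ k)) ≤ C₂ := fun k => by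
    have h1 := hC₂ _ (hrk (k + 1))
    have h2 : 16 * (r / 16 ^ (k + 1)) = r / 16 ^ k := by field_simp; ring
    rw [h2] at h1
    have h0 := hΨ.pos (hrk (k + 1))
    calc _ ≤ w k * (C₂ * ENNReal.ofReal (Ψ (r / 16 ^ (k + 1)))) := by gcongr
      _ = C₂ * (w k * ENNReal.ofReal (Ψ (r / 16 ^ (k + 1)))) := by ring
      _ ≤ C₂ * 1 := by gcongr; exact ENNReal.inv_mul_le_one _
      _ = C₂ := mul_one _
  calc _ ≤ ∫⁻ y in D, ∑' k : ℕ, (θ : ℝ≥0∞) ^ k * w k * meanOsc m p v (r / 16 ^ k) y ∂m :=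
        lintegral_mono hinner
    _ = ∑' k : ℕ, (θ : ℝ≥0∞) ^ k * w k * ∫⁻ y in D, meanOsc m p v (r / 16 ^ k) y ∂m := by
        rw [lintegral_tsum fun k => ((measurable_meanOsc hvm _).const_mul _).aemeasurable]
        exact tsum_congr fun k => lintegral_const_mul _ (measurable_meanOsc hvm _)
    _ ≤ ∑' k : ℕ, (θ : ℝ≥0∞) ^ k * (C₂ * C * 𝓔.Γ u (Metric.thickening (κ * r) D)) := by
        refine ENNReal.tsum_le_tsum fun k => ?_
        rw [mul_assoc]
        refine mul_le_mul' le_rfl ?_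
        calc w k * ∫⁻ y in D, meanOsc m p v (r / 16 ^ k) y ∂m
            ≤ w k * (C * ENNReal.ofReal (Ψ (r / 16 ^ k)) *
              𝓔.Γ u (Metric.thickening (κ * (r / 16 ^ k)) D)) := by
              gcongr
              exact hC u _ (hrk k) D
          _ = w k * ENNReal.ofReal (Ψ (r / 16 ^ k)) * C *
              𝓔.Γ u (Metric.thickening (κ * (r / 16 ^ k)) D) := by ring
          _ ≤ C₂ * C * 𝓔.Γ u (Metric.thickening (κ * r) D) := by
              gcongr
              · exact hwC k
              · exact div_le_self hr.le (one_le_pow₀ (by norm_num))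
    _ = _ := by
        rw [ENNReal.tsum_mul_right, ENNReal.tsum_geometric, ENNReal.coe_mul,
          ENNReal.coe_inv (tsub_pos_of_lt hθ1).ne']
        push_cast
        ring

end PEnergyStructure

/-! ### Jensen's inequality for means -/

theorem ofReal_abs_sub_integral_rpow_le {X : Type*} [MeasurableSpace X] {μ : Measure X}
    [IsProbabilityMeasure μ] {p : ℝ} (hp : 1 ≤ p) {f : X → ℝ} (hf : Integrable f μ) (c : ℝ) :
    ENNReal.ofReal (|c - ∫ x, f x ∂μ| ^ p) ≤ ∫⁻ x, ENNReal.ofReal (|f x - c| ^ p) ∂μ := by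
  have hp0 : 0 < p := by linarith
  have hen : ∀ t : ℝ, ENNReal.ofReal (|t| ^ p) = ‖t‖ₑ ^ p := fun t => by
    rw [← ENNReal.ofReal_rpow_of_nonneg (abs_nonneg _) hp0.le, ← Real.norm_eq_abs, ofReal_norm]
  have h1 : ∫ x, (f x - c) ∂μ = ∫ x, f x ∂μ - c := by
    rw [integral_sub hf (integrable_const c)]; simp
  have h2 : ‖∫ x, f x ∂μ - c‖ₑ ≤ eLpNorm (fun x => f x - c) (ENNReal.ofReal p) μ := by
    rw [← h1]
    refine (enorm_integral_le_lintegral_enorm _).trans ?_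
    rw [← eLpNorm_one_eq_lintegral_enorm]
    exact eLpNorm_le_eLpNorm_of_exponent_le (by simpa using hp)
      (hf.aestronglyMeasurable.sub aestronglyMeasurable_const)
  rw [eLpNorm_eq_lintegral_rpow_enorm_toReal (by simpa using hp0) ENNReal.ofReal_ne_top,
    ENNReal.toReal_ofReal hp0.le] at h2
  have h3 := ENNReal.rpow_le_rpow h2 hp0.le
  rw [← ENNReal.rpow_mul, one_div_mul_cancel hp0.ne', ENNReal.rpow_one] at h3
  rw [abs_sub_comm, hen]
  simpa only [hen] using h3

theorem ofReal_abs_sub_setAverage_rpow_le {X : Type*} [MeasurableSpace X] {m : Measure X} {p : ℝ}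
    (hp : 1 ≤ p) {B : Set X} (hB0 : m B ≠ 0) (hBt : m B ≠ ∞) {f : X → ℝ}
    (hf : IntegrableOn f B m) (c : ℝ) :
    ENNReal.ofReal (|c - ⨍ x in B, f x ∂m| ^ p) ≤
      (m B)⁻¹ * ∫⁻ x in B, ENNReal.ofReal (|f x - c| ^ p) ∂m := by
  have hprob : IsProbabilityMeasure ((m.restrict B univ)⁻¹ • m.restrict B) := by
    constructor
    simp only [Measure.restrict_apply_univ, Measure.smul_apply, smul_eq_mul]
    exact ENNReal.inv_mul_cancel hB0 hBt
  have h := ofReal_abs_sub_integral_rpow_le hp (hf.integrable.smul_measure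
    (c := (m.restrict B univ)⁻¹) (by simpa using hB0)) c
  rw [lintegral_smul_measure, smul_eq_mul] at h
  change ENNReal.ofReal (|c - ⨍ x in B, f x ∂m| ^ p) ≤ _ at h
  rwa [Measure.restrict_apply_univ] at h

/-! ### Partitions of unity by truncated sums -/

/-- With `G` truncation at `1`, this yields a partition of unity using only sums and contractions,
whereas normalizing by the sum would require quotients of elements of the domain. -/
theorem sum_telescope {ι : Type*} [DecidableEq ι] (e : ι → ℕ) (f : ι → ℝ) (G : ℝ → ℝ)
    (T : Finset ι) (he : InjOn e T) :
    ∑ i ∈ T, (G (∑ j ∈ T with e j ≤ e i, f j) - G (∑ j ∈ T with e j < e i, f j)) =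
      G (∑ j ∈ T, f j) - G 0 := by
  induction T using Finset.induction_on_max_value e with
  | empty => simp
  | insert a s ha hmax ih =>
    have hlt : ∀ x ∈ s, e x < e a := fun x hx => lt_of_le_of_ne (hmax x hx) fun h =>
      ha (he (Finset.mem_insert_of_mem hx) (Finset.mem_insert_self a s) h ▸ hx)
    have h1 : {j ∈ insert a s | e j ≤ e a} = insert a s := Finset.filter_true_of_mem fun x hx => by
      rcases Finset.mem_insert.1 hx with rfl | hx
      · exact le_rfl
      · exact hmax x hx
    have h2 : {j ∈ insert a s | e j < e a} = s := by
      rw [Finset.filter_insert, if_neg (lt_irrefl _), Finset.filter_true_of_mem hlt]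
    have h3 : ∀ i ∈ s, {j ∈ insert a s | e j ≤ e i} = {j ∈ s | e j ≤ e i} := fun i hi => by
      rw [Finset.filter_insert, if_neg (not_le.2 (hlt i hi))]
    have h4 : ∀ i ∈ s, {j ∈ insert a s | e j < e i} = {j ∈ s | e j < e i} := fun i hi => by
      rw [Finset.filter_insert, if_neg (not_lt.2 (hlt i hi).le)]
    have h5 : ∑ i ∈ s, (G (∑ j ∈ insert a s with e j ≤ e i, f j) -
        G (∑ j ∈ insert a s with e j < e i, f j)) = G (∑ j ∈ s, f j) - G 0 := by
      rw [← ih (he.mono (by simp))]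
      exact Finset.sum_congr rfl fun i hi => by rw [h3 i hi, h4 i hi]
    rw [Finset.sum_insert ha, h1, h2, h5]
    ring

/-- The increment at `i` of the truncated partial sums of `f` over `N`, along the order given
by `e`. -/
def truncIncr {ι : Type*} (e : ι → ℕ) (f : ι → ℝ) (N : Finset ι) (i : ι) : ℝ :=
  min (∑ j ∈ N with e j ≤ e i, f j) 1 - min (∑ j ∈ N with e j < e i, f j) 1

section TruncIncr

variable {ι : Type*} {e : ι → ℕ} {f : ι → ℝ} {N : Finset ι} {i : ι}

theorem truncIncr_nonneg (hf : ∀ j ∈ N, 0 ≤ f j) : 0 ≤ truncIncr e f N i := by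
  refine sub_nonneg.2 (min_le_min_right _ (Finset.sum_le_sum_of_subset_of_nonneg ?_ ?_))
  · intro j hj
    rw [Finset.mem_filter] at hj ⊢
    exact ⟨hj.1, hj.2.le⟩
  · exact fun j hj _ => hf j (Finset.mem_filter.1 hj).1

theorem truncIncr_eq_zero (he : ∀ j ∈ N, e j = e i → j = i) (hf : f i = 0) :
    truncIncr e f N i = 0 := by
  have : ∑ j ∈ N with e j < e i, f j = ∑ j ∈ N with e j ≤ e i, f j := by
    refine Finset.sum_subset (fun j hj => ?_) fun j hj hj' => ?_
    · rw [Finset.mem_filter] at hj ⊢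
      exact ⟨hj.1, hj.2.le⟩
    · rw [Finset.mem_filter] at hj hj'
      have : e j = e i := le_antisymm hj.2 (not_lt.1 fun h => hj' ⟨hj.1, h⟩)
      rw [he j hj.1 this, hf]
  rw [truncIncr, this, sub_self]

theorem truncIncr_congr {N' : Finset ι} (h : ∀ j, f j ≠ 0 → (j ∈ N ↔ j ∈ N')) :
    truncIncr e f N i = truncIncr e f N' i := by
  have key : ∀ P : ι → Prop, [DecidablePred P] → ∑ j ∈ N with P j, f j = ∑ j ∈ N' with P j, f j := by
    intro P _
    rw [← Finset.sum_filter_ne_zero, ← Finset.sum_filter_ne_zero (s := {j ∈ N' | P j})]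
    refine Finset.sum_congr ?_ fun _ _ => rfl
    ext j
    simp only [Finset.mem_filter]
    constructor <;> rintro ⟨⟨h1, h2⟩, h3⟩
    · exact ⟨⟨(h j h3).1 h1, h2⟩, h3⟩
    · exact ⟨⟨(h j h3).2 h1, h2⟩, h3⟩
  rw [truncIncr, truncIncr, key, key]

/-- Each increment uses only the neighbours of its own index, so that its energy involves boundedly
many cutoffs. At a given point these neighbourhoods agree with `N₀` on the cutoffs that are nonzero,
so the telescoping over `N₀` is unaffected. -/
theorem sum_truncIncr_eq_one [DecidableEq ι] {N : ι → Finset ι} {N₀ : Finset ι}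
    (he : ∀ i ∈ N₀, ∀ j ∈ N i, e j = e i → j = i) (he₀ : InjOn e N₀)
    (h : ∀ i ∈ N₀, f i ≠ 0 → ∀ j, f j ≠ 0 → (j ∈ N i ↔ j ∈ N₀))
    (h1 : 1 ≤ ∑ j ∈ N₀, f j) : ∑ i ∈ N₀, truncIncr e f (N i) i = 1 := by
  have h2 : ∀ i ∈ N₀, truncIncr e f (N i) i = truncIncr e f N₀ i := fun i hi => by
    by_cases hfi : f i = 0
    · rw [truncIncr_eq_zero (he i hi) hfi,
        truncIncr_eq_zero (fun j hj hji => he₀ hj hi hji) hfi]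
    · exact truncIncr_congr (h i hi hfi)
  rw [Finset.sum_congr rfl h2]
  have h3 := sum_telescope e f (fun t => min t 1) N₀ he₀
  rw [min_eq_right h1, min_eq_left zero_le_one, sub_zero] at h3
  exact h3

end TruncIncr

namespace PEnergyStructure

variable {X : Type*} [MetricSpace X] [MeasurableSpace X] [BorelSpace X]
  {m : Measure X} {p : ℝ} [Fact (1 < p)]

theorem integrableOn_val (𝓔 : PEnergyStructure X m p) (u : 𝓔.F) {B : Set X} (hB : m B ≠ ∞) :
    IntegrableOn (𝓔.val u) B m := by
  have : IsFiniteMeasure (m.restrict B) := ⟨by simpa using hB.lt_top⟩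
  have h : MemLp (𝓔.val u) (ENNReal.ofReal p) m := Lp.memLp _
  exact (h.restrict B).integrable (by simpa using (one_lt_exponent p).le)

theorem Γ_sub_le (𝓔 : PEnergyStructure X m p) {A : Set X} (hA : MeasurableSet A)
    (u v : 𝓔.F) : 𝓔.Γ (u - v) A ≤ 2 ^ p * (𝓔.Γ u A + 𝓔.Γ v A) := by
  have := 𝓔.Γ_add_le hA u (-v)
  rwa [← sub_eq_add_neg, 𝓔.Γ_neg hA] at this

theorem exists_capacity_cutoff [Nontrivial X] [IsLocallyFiniteMeasure m] [m.IsOpenPosMeasure]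
    (𝓔 : PEnergyStructure X m p) {Ψ : ℝ → ℝ} (hΨ : IsScaleFunction Ψ) (hVD : VolumeDoubling m)
    (hcap : 𝓔.CapacityUpper Ψ) :
    ∃ (C : ℝ≥0) (A r₀ : ℝ), 1 < A ∧ 0 < r₀ ∧ ∀ (x : X) (r : ℝ), 0 < r → r < r₀ → ∃ φ : 𝓔.F,
      (∀ᵐ y ∂m, 0 ≤ 𝓔.val φ y ∧ (y ∈ Metric.ball x r → 𝓔.val φ y = 1) ∧
        (y ∉ Metric.ball x (A * r) → 𝓔.val φ y = 0)) ∧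
      𝓔.Γ φ univ ≤ C * (m (Metric.ball x r) * (ENNReal.ofReal (Ψ r))⁻¹) := by
  obtain ⟨C, A₁, A₂, hC, hA₁, hA₂, hcap⟩ := hcap
  obtain ⟨a, b, hab⟩ := exists_pair_ne X
  have hd : 0 < dist a b := dist_pos.2 hab
  -- The distance of two fixed points replaces the diameter, which may be infinite. The factor `2`
  -- leaves room above the infimum to choose an actual competitor.
  refine ⟨2 * C.toNNReal, A₁, dist a b / A₂, hA₁, by positivity, fun x r hr hr₀ => ?_⟩
  have h1 := hcap x r hr (by
    calc ENNReal.ofReal r < ENNReal.ofReal (dist a b / A₂) :=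
          (ENNReal.ofReal_lt_ofReal_iff (by positivity)).2 hr₀
      _ = edist a b / ENNReal.ofReal A₂ := by
          rw [ENNReal.ofReal_div_of_pos (by positivity), edist_dist]
      _ ≤ _ := by gcongr; exact Metric.edist_le_ediam_of_mem (mem_univ a) (mem_univ b))
  set t := m (Metric.ball x r) * (ENNReal.ofReal (Ψ r))⁻¹ with ht
  rw [ENNReal.div_eq_inv_mul, mul_comm _ (m _), ← ht] at h1
  have hC0 : ENNReal.ofReal C ≠ 0 := by simp; linarith
  have ht0 : t ≠ 0 := mul_ne_zero (Metric.measure_ball_pos m x hr).ne' (by simp)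
  have htt : t ≠ ∞ := ENNReal.mul_ne_top (hVD.ball_lt_top x r).ne (by simpa using hΨ.pos hr)
  have h2 : ENNReal.ofReal C * t < 2 * (ENNReal.ofReal C * t) := by
    rw [two_mul]
    exact ENNReal.lt_add_right (ENNReal.mul_ne_top ENNReal.ofReal_ne_top htt) (mul_ne_zero hC0 ht0)
  obtain ⟨u, hu⟩ := iInf_lt_iff.1 (h1.trans_lt h2)
  obtain ⟨⟨hu1, hu0⟩, huE⟩ := iInf_lt_iff.1 hu
  obtain ⟨φ, hφ, hφE⟩ := 𝓔.exists_contraction u (φ := fun t => max (min t 1) 0)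
    ((LipschitzWith.id.min_const _).max_const _) (by norm_num)
  refine ⟨φ, ?_, ?_⟩
  · filter_upwards [hu1, hu0, hφ] with y h3 h4 h5
    rw [h5]
    refine ⟨le_max_right _ _, fun h => ?_, fun h => ?_⟩
    · rw [h3 h]; norm_num
    · rw [h4 h]; norm_num
  · rw [𝓔.ofReal_E] at huE
    refine hφE.trans (huE.le.trans_eq ?_)
    rw [ENNReal.coe_mul, ENNReal.ofReal]
    push_cast
    ring

/-! ### Discrete approximation -/

/-- Truncated sums operate on the domain. -/
theorem exists_min_sum (𝓔 : PEnergyStructure X m p) {ι : Type*} (φ : ι → 𝓔.F) (T : Finset ι) :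
    ∃ w : 𝓔.F, (∀ᵐ x ∂m, 𝓔.val w x = min (∑ j ∈ T, 𝓔.val (φ j) x) 1) ∧
      ∀ b : ℝ≥0∞, (∀ j ∈ T, 𝓔.Γ (φ j) univ ≤ b) → 𝓔.Γ w univ ≤ (T.card : ℝ≥0∞) ^ p * b := by
  obtain ⟨w, hw, hwE⟩ := 𝓔.exists_contraction (∑ j ∈ T, φ j) (φ := fun t => min t 1)
    (LipschitzWith.id.min_const _) (by norm_num)
  refine ⟨w, ?_, fun b hb => hwE.trans (𝓔.Γ_sum_le MeasurableSet.univ T φ hb)⟩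
  filter_upwards [hw, 𝓔.val_sum T φ] with x h1 h2
  rw [h1, h2]

/-- A partition of unity subordinate to balls of radius comparable to `r`, with neighbours `N`. -/
theorem exists_truncIncr (𝓔 : PEnergyStructure X m p) {ι : Type*} (e : ι → ℕ) (φ : ι → 𝓔.F)
    (N : Finset ι) (i : ι) {M : ℕ} (hM : N.card ≤ M) {b : ℝ≥0∞}
    (hb : ∀ j ∈ N, 𝓔.Γ (φ j) univ ≤ b) :
    ∃ ψ : 𝓔.F, (∀ᵐ x ∂m, 𝓔.val ψ x = truncIncr e (fun j => 𝓔.val (φ j) x) N i) ∧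
      𝓔.Γ ψ univ ≤ 2 ^ p * (2 * ((M : ℝ≥0∞) ^ p * b)) := by
  have hp := exponent_pos p
  obtain ⟨w₁, h1, hw₁⟩ := 𝓔.exists_min_sum φ {j ∈ N | e j ≤ e i}
  obtain ⟨w₂, h2, hw₂⟩ := 𝓔.exists_min_sum φ {j ∈ N | e j < e i}
  have hcard : ∀ (P : ι → Prop) [DecidablePred P],
      (({j ∈ N | P j}.card : ℕ) : ℝ≥0∞) ^ p * b ≤ (M : ℝ≥0∞) ^ p * b := fun P _ => by
    gcongr
    exact (Finset.card_filter_le _ _).trans hM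
  refine ⟨w₁ - w₂, ?_, ?_⟩
  · filter_upwards [h1, h2, 𝓔.val_sub w₁ w₂] with x h3 h4 h5
    rw [h5, Pi.sub_apply, h3, h4]
    rfl
  · refine (𝓔.Γ_sub_le MeasurableSet.univ w₁ w₂).trans ?_
    rw [two_mul ((M : ℝ≥0∞) ^ p * b)]
    gcongr
    · exact (hw₁ b fun j hj => hb j (Finset.mem_filter.1 hj).1).trans (hcard _)
    · exact (hw₂ b fun j hj => hb j (Finset.mem_filter.1 hj).1).trans (hcard _)

/-- The approximation is `v = ∑ a_i ψ_i`, with `a_i` the mean of `u` over a net ball and `ψ_i` the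
partition of unity. On the cell of `i₀`, subtracting `a_{i₀}` does not change the energy, so only
differences of neighbouring means enter. Jensen bounds these by oscillations, and the capacity bound
on `ψ_i` supplies `1/Ψ(r)`. -/
theorem exists_approx [Nontrivial X] [ProperSpace X] [SecondCountableTopology X]
    [IsLocallyFiniteMeasure m] [m.IsOpenPosMeasure]
    (𝓔 : PEnergyStructure X m p) {Ψ : ℝ → ℝ} (hΨ : IsScaleFunction Ψ) (hVD : VolumeDoubling m)
    (hcap : 𝓔.CapacityUpper Ψ) :
    ∃ (C : ℝ≥0) (k r₀ : ℝ), 1 ≤ k ∧ 0 < r₀ ∧ ∀ (u : 𝓔.F) (o : X) (R : ℝ),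
      (∀ᵐ x ∂m, x ∉ Metric.ball o R → 𝓔.val u x = 0) → ∀ r : ℝ, 0 < r → r < r₀ → ∃ v : 𝓔.F,
        (∀ A : Set X, 𝓔.Γ v A ≤ C * (ENNReal.ofReal (Ψ r))⁻¹ *
          ∫⁻ y in Metric.thickening (2 * r) A, meanOsc m p (𝓔.val u) (k * r) y ∂m) ∧
        ∫⁻ x, ENNReal.ofReal (|𝓔.val v x - 𝓔.val u x| ^ p) ∂m ≤
          C * ∫⁻ y, meanOsc m p (𝓔.val u) (k * r) y ∂m := by
  classical
  have hp := exponent_pos p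
  have hp1 := (one_lt_exponent p).le
  obtain ⟨C₁, A, r₀, hA, hr₀, hφ⟩ := 𝓔.exists_capacity_cutoff hΨ hVD hcap
  -- For `y` in the cell of `i₀` and a neighbour `i` within `2Ar` of `i₀`, one has `d(y,i) <
  -- (2A+1)r`, so `B(i,r)` lies in `B(y,kr)`.
  set k := 2 * A + 2 with hk
  obtain ⟨c, hc1, hc⟩ := hVD.exists_le k
  obtain ⟨M, hM⟩ := hVD.exists_card_le (κ := 2 * A) (by linarith)
  obtain ⟨M₁, hM₁⟩ := hVD.exists_tsum_le (κ := 1) zero_le_one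
  set K : ℝ≥0 := c * ((M : ℝ≥0) ^ p * (2 ^ p * (2 * (M ^ p * (C₁ * c))) * c)) with hK
  refine ⟨max (K * M₁) c, k, r₀, by linarith, hr₀, fun u o R hu r hr hrr => ?_⟩
  set v' := 𝓔.val u with hv'
  have hvm : Measurable v' := 𝓔.measurable_val u
  set W := meanOsc m p v' (k * r) with hW
  have hWm : Measurable W := measurable_meanOsc hvm _
  obtain ⟨S, hS⟩ := exists_isNet (X := X) hr
  have hSc : S.Countable := hS.countable hVD hr
  obtain ⟨e, he⟩ := countable_iff_exists_injOn.1 hSc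
  choose φ hφ1 hφE using fun x => hφ x r hr hrr
  have hNfin := fun i : X => hS.finite_inter_ball hVD hr i (2 * A * r)
  set N : X → Finset X := fun i => (hNfin i).toFinset with hN
  have hmemN : ∀ i j, j ∈ N i ↔ j ∈ S ∧ dist j i < 2 * A * r := fun i j => by simp [hN]
  have hNM : ∀ i, (N i).card ≤ M := fun i =>
    hM r hr (N i) (fun a ha b hb => hS.separated a ((hmemN _ _).1 ha).1 b ((hmemN _ _).1 hb).1) i
      fun a ha => ((hmemN _ _).1 ha).2
  have hB0 : ∀ i, m (Metric.ball i r) ≠ 0 := fun i => (Metric.measure_ball_pos m i hr).ne'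
  have hBt : ∀ i, m (Metric.ball i r) ≠ ∞ := fun i => (hVD.ball_lt_top i r).ne
  have hAr : r < A * r := by nlinarith
  have hBB : ∀ i j, dist i j < k * r → m (Metric.ball j r) ≤ c * m (Metric.ball i r) :=
    fun i j h => (measure_mono (Metric.ball_subset_ball (by nlinarith))).trans
      (hc i j r hr (by rwa [dist_comm]))
  have hψ : ∀ i, ∃ ψ : 𝓔.F, (∀ᵐ x ∂m, 𝓔.val ψ x = truncIncr e (fun j => 𝓔.val (φ j) x) (N i) i) ∧
      𝓔.Γ ψ univ ≤ 2 ^ p * (2 * ((M : ℝ≥0∞) ^ p *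
        (C₁ * (c * m (Metric.ball i r) * (ENNReal.ofReal (Ψ r))⁻¹)))) := fun i =>
    𝓔.exists_truncIncr e φ (N i) i (hNM i) fun j hj => (hφE j).trans (by
      gcongr
      refine hBB i j ?_
      rw [dist_comm]
      linarith [((hmemN i j).1 hj).2])
  choose ψ hψv hψE using hψ
  have hgood : ∀ᵐ x ∂m, (∀ j ∈ S, 0 ≤ 𝓔.val (φ j) x ∧
      (x ∈ Metric.ball j r → 𝓔.val (φ j) x = 1) ∧
      (x ∉ Metric.ball j (A * r) → 𝓔.val (φ j) x = 0)) ∧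
      ∀ i ∈ S, 𝓔.val (ψ i) x = truncIncr e (fun j => 𝓔.val (φ j) x) (N i) i :=
    ((ae_ball_iff hSc).2 fun j _ => hφ1 j).and ((ae_ball_iff hSc).2 fun i _ => hψv i)
  have hpart : ∀ᵐ x ∂m, ∀ i₀ ∈ S, x ∈ Metric.ball i₀ r →
      (∀ i ∈ S, 0 ≤ 𝓔.val (ψ i) x) ∧ (∀ i ∈ S, i ∉ N i₀ → 𝓔.val (ψ i) x = 0) ∧
        ∑ i ∈ N i₀, 𝓔.val (ψ i) x = 1 := by
    filter_upwards [hgood] with x hx i₀ hi₀ hxi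
    obtain ⟨h1, h2⟩ := hx
    have hNS : ∀ i, ∀ j ∈ N i, j ∈ S := fun i j hj => ((hmemN i j).1 hj).1
    have hnear : ∀ j ∈ S, 𝓔.val (φ j) x ≠ 0 → dist x j < A * r := fun j hj h => by
      by_contra h3
      exact h ((h1 j hj).2.2 h3)
    rw [Metric.mem_ball] at hxi
    refine ⟨fun i hi => ?_, fun i hi hiN => ?_, ?_⟩
    · rw [h2 i hi]
      exact truncIncr_nonneg fun j hj => (h1 j (hNS i j hj)).1
    · rw [h2 i hi]
      refine truncIncr_eq_zero (fun j hj hji => he (hNS i j hj) hi hji) ?_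
      by_contra h3
      refine hiN ((hmemN _ _).2 ⟨hi, ?_⟩)
      linarith [hnear i hi h3, dist_triangle_left i i₀ x]
    · rw [Finset.sum_congr rfl fun i hi => h2 i (hNS i₀ i hi)]
      refine sum_truncIncr_eq_one (fun i hi j hj hji => he (hNS i j hj) (hNS i₀ i hi) hji)
        (fun a ha b hb hab => he (hNS i₀ a ha) (hNS i₀ b hb) hab) (fun i hi hfi j hfj => ?_) ?_
      · rw [hmemN, hmemN]
        refine and_congr_right fun hj => ?_
        have h3 := hnear j hj hfj
        have h4 := hnear i (hNS i₀ i hi) hfi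
        constructor <;> intro _
        · linarith [dist_triangle_left j i₀ x]
        · linarith [dist_triangle_left j i x]
      · have h5 : i₀ ∈ N i₀ := (hmemN _ _).2 ⟨hi₀, by rw [dist_self]; nlinarith⟩
        have h6 := Finset.single_le_sum (f := fun j => 𝓔.val (φ j) x)
          (fun j hj => (h1 j (hNS i₀ j hj)).1) h5
        rwa [(h1 i₀ hi₀).2.1 hxi] at h6
  set a : X → ℝ := fun i => ⨍ z in Metric.ball i r, v' z ∂m with ha
  -- Bounded support of `u` makes `v` a finite sum: the mean vanishes over net balls centred outside
  -- `B(o, R+r)`.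
  have hTfin := hS.finite_inter_ball hVD hr o (R + r)
  set T : Finset X := hTfin.toFinset with hT
  have hmemT : ∀ j, j ∈ T ↔ j ∈ S ∧ dist j o < R + r := fun j => by simp [hT]
  have haT : ∀ i ∈ S, i ∉ T → a i = 0 := fun i hi hiT => by
    refine (setAverage_congr_fun Metric.isOpen_ball.measurableSet (g := fun _ => 0) ?_).trans
      (by simp)
    filter_upwards [hu] with x hx hxi
    refine hx fun hxo => hiT ((hmemT i).2 ⟨hi, ?_⟩)
    rw [Metric.mem_ball] at hxi hxo
    linarith [dist_triangle_left i o x]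
  have hpt : ∀ i₀ i, i ∈ N i₀ → ∀ y ∈ Metric.ball i₀ r,
      ENNReal.ofReal (|v' y - a i| ^ p) ≤ c * W y := fun i₀ i hi y hy => by
    have h1 := ((hmemN i₀ i).1 hi).2
    rw [Metric.mem_ball] at hy
    have hd : dist y i < (2 * A + 1) * r := by linarith [dist_triangle_right y i i₀]
    refine (ofReal_abs_sub_setAverage_rpow_le hp1 (hB0 i) (hBt i)
      (𝓔.integrableOn_val u (hBt i)) _).trans ?_
    rw [hW, meanOsc, ← mul_assoc]
    refine mul_le_mul' ?_ (lintegral_mono_set (Metric.ball_subset_ball' ?_))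
    · refine ENNReal.inv_le_mul_inv_of_le_mul (hc i y r hr (by linarith)) ?_ (hVD.ball_lt_top _ _).ne
      exact (Metric.measure_ball_pos m y (by positivity)).ne'
    · rw [dist_comm]
      linarith
  set v : 𝓔.F := ∑ i ∈ T, a i • ψ i with hv
  have hval : ∀ᵐ x ∂m, 𝓔.val v x = ∑ i ∈ T, a i * 𝓔.val (ψ i) x := by
    have h1 : ∀ᵐ x ∂m, ∀ i ∈ T, 𝓔.val (a i • ψ i) x = a i * 𝓔.val (ψ i) x :=
      (ae_ball_iff T.countable_toSet).2 fun i _ => 𝓔.val_smul (a i) (ψ i)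
    filter_upwards [h1, 𝓔.val_sum T fun i => a i • ψ i] with x h2 h3
    rw [h3]
    exact Finset.sum_congr rfl h2
  have hlocal : ∀ᵐ x ∂m, ∀ i₀ ∈ S, x ∈ Metric.ball i₀ r →
      𝓔.val v x = ∑ i ∈ N i₀, a i * 𝓔.val (ψ i) x := by
    filter_upwards [hval, hpart] with x h1 h2 i₀ hi₀ hx
    rw [h1]
    obtain ⟨-, h3, -⟩ := h2 i₀ hi₀ hx
    refine (Finset.sum_subset (Finset.subset_union_left (s₂ := N i₀)) fun i hi hiT => ?_).trans
      (Finset.sum_subset (Finset.subset_union_right (s₁ := T)) fun i hi hiN => ?_).symm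
    · have hiN := (Finset.mem_union.1 hi).resolve_left hiT
      rw [haT i ((hmemN _ _).1 hiN).1 hiT, zero_mul]
    · have hiT := (Finset.mem_union.1 hi).resolve_right hiN
      rw [h3 i ((hmemT _).1 hiT).1 hiN, mul_zero]
  have hcell : ∀ i₀ ∈ S, 𝓔.Γ v (Metric.ball i₀ r) ≤
      K * (ENNReal.ofReal (Ψ r))⁻¹ * ∫⁻ y in Metric.ball i₀ r, W y ∂m := fun i₀ hi₀ => by
    set B := Metric.ball i₀ r with hB
    have hBm : MeasurableSet B := Metric.isOpen_ball.measurableSet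
    -- On this cell the `ψ_i` with `i ∈ N i₀` sum to `1`, so the two functions differ by the
    -- constant `a i₀`.
    have h1 : 𝓔.Γ v B = 𝓔.Γ (∑ i ∈ N i₀, (a i - a i₀) • ψ i) B := by
      refine 𝓔.Γ_eq_of_ae_sub_const Metric.isOpen_ball (U := B) (c := a i₀) ?_ hBm subset_rfl
      have h2 : ∀ᵐ x ∂m, ∀ i ∈ N i₀, 𝓔.val ((a i - a i₀) • ψ i) x =
          (a i - a i₀) * 𝓔.val (ψ i) x :=
        (ae_ball_iff (N i₀).countable_toSet).2 fun i _ => 𝓔.val_smul (a i - a i₀) (ψ i)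
      filter_upwards [hlocal, hpart, h2, 𝓔.val_sum (N i₀) fun i => (a i - a i₀) • ψ i]
        with x h3 h4 h5 h6 hx
      rw [h3 i₀ hi₀ hx, h6, Finset.sum_congr rfl h5, ← Finset.sum_sub_distrib]
      obtain ⟨-, -, h7⟩ := h4 i₀ hi₀ hx
      have h8 : a i₀ = ∑ i ∈ N i₀, a i₀ * 𝓔.val (ψ i) x := by rw [← Finset.mul_sum, h7, mul_one]
      conv_rhs => rw [h8]
      refine Finset.sum_congr rfl fun i _ => ?_
      ring
    rw [h1]
    refine (𝓔.Γ_sum_le hBm (N i₀) _ (b := ((m B)⁻¹ * (c * ∫⁻ y in B, W y ∂m)) *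
      (2 ^ p * (2 * ((M : ℝ≥0∞) ^ p * (C₁ * (c * (c * m B) * (ENNReal.ofReal (Ψ r))⁻¹))))))
      fun i hi => ?_).trans ?_
    · rw [𝓔.Γ_smul hBm]
      refine mul_le_mul' ?_ ?_
      · refine (ofReal_abs_sub_setAverage_rpow_le hp1 (hB0 i₀) (hBt i₀)
          (𝓔.integrableOn_val u (hBt i₀)) _).trans ?_
        gcongr
        rw [← lintegral_const_mul _ hWm]
        exact setLIntegral_mono' hBm fun y hy => hpt i₀ i hi y hy
      · refine (measure_mono (subset_univ _)).trans ((hψE i).trans ?_)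
        gcongr
        refine hBB i₀ i ?_
        rw [dist_comm]
        linarith [((hmemN i₀ i).1 hi).2]
    · calc _ ≤ (M : ℝ≥0∞) ^ p * ((m B)⁻¹ * (c * ∫⁻ y in B, W y ∂m) *
            (2 ^ p * (2 * (M ^ p * (C₁ * (c * (c * m B) * (ENNReal.ofReal (Ψ r))⁻¹)))))) := by
            gcongr
            exact hNM i₀
        _ = (c * (M ^ p * (2 ^ p * (2 * (M ^ p * (C₁ * c))) * c)) : ℝ≥0∞) *
            (ENNReal.ofReal (Ψ r))⁻¹ * (∫⁻ y in B, W y ∂m) * ((m B)⁻¹ * m B) := by ring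
        _ ≤ (c * (M ^ p * (2 ^ p * (2 * (M ^ p * (C₁ * c))) * c)) : ℝ≥0∞) *
            (ENNReal.ofReal (Ψ r))⁻¹ * (∫⁻ y in B, W y ∂m) * 1 := by
            gcongr
            exact ENNReal.inv_mul_le_one _
        _ = _ := by
            rw [mul_one, hK]
            push_cast
            rw [ENNReal.coe_rpow_of_nonneg _ hp.le, ENNReal.coe_rpow_of_nonneg _ hp.le]
            push_cast
            rfl
  refine ⟨v, fun D => ?_, ?_⟩
  · set S' : Set X := {i ∈ S | (Metric.ball i r ∩ D).Nonempty} with hS'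
    have hS'S : S' ⊆ S := fun i hi => hi.1
    have hcount : Countable S' := (hSc.mono hS'S).to_subtype
    set U := ⋃ i ∈ S', Metric.ball i (1 * r) with hU
    have hUo : MeasurableSet U := (isOpen_biUnion fun i _ => Metric.isOpen_ball).measurableSet
    have hcover : D ⊆ ⋃ i : S', Metric.ball (i : X) r := fun y hy => by
      obtain ⟨i, hi, hyi⟩ := hS.cover y
      exact mem_iUnion.2 ⟨⟨i, hi, y, hyi, hy⟩, hyi⟩
    have hUD : U ⊆ Metric.thickening (2 * r) D := by
      refine iUnion₂_subset fun i hi z hz => ?_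
      obtain ⟨-, d, hd, hdD⟩ := hi
      refine Metric.mem_thickening_iff.2 ⟨d, hdD, ?_⟩
      rw [Metric.mem_ball] at hz hd
      linarith [dist_triangle_right z d i]
    calc 𝓔.Γ v D ≤ ∑' i : S', 𝓔.Γ v (Metric.ball (i : X) r) :=
          (measure_mono hcover).trans (measure_iUnion_le _)
      _ ≤ ∑' i : S', K * (ENNReal.ofReal (Ψ r))⁻¹ *
            (m.withDensity W) (Metric.ball (i : X) (1 * r)) := by
          refine ENNReal.tsum_le_tsum fun i => ?_
          rw [one_mul, withDensity_apply _ Metric.isOpen_ball.measurableSet]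
          exact hcell i (hS'S i.2)
      _ ≤ K * (ENNReal.ofReal (Ψ r))⁻¹ * (M₁ * (m.withDensity W) U) := by
          rw [ENNReal.tsum_mul_left]
          gcongr
          exact hM₁ r hr S hS S' hS'S _
      _ = (K * M₁ : ℝ≥0) * (ENNReal.ofReal (Ψ r))⁻¹ * ∫⁻ y in U, W y ∂m := by
          rw [withDensity_apply _ hUo]
          push_cast
          ring
      _ ≤ _ := by
          gcongr
          · exact le_max_left _ _
  · have h1 : ∀ᵐ x ∂m, ENNReal.ofReal (|𝓔.val v x - v' x| ^ p) ≤ c * W x := by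
      filter_upwards [hlocal, hpart] with x h2 h3
      obtain ⟨i₀, hi₀, hx⟩ := hS.cover x
      obtain ⟨h4, -, h5⟩ := h3 i₀ hi₀ hx
      have hNS : ∀ j ∈ N i₀, j ∈ S := fun j hj => ((hmemN i₀ j).1 hj).1
      have hne : (N i₀).Nonempty := by
        rw [Finset.nonempty_iff_ne_empty]
        intro h
        rw [h, Finset.sum_empty] at h5
        exact zero_ne_one h5
      -- The value `v(x)` is a convex combination of neighbouring means, so its error is at most
      -- that of the worst mean.
      obtain ⟨i, hi, himax⟩ := Finset.exists_max_image (N i₀) (fun i => |v' x - a i|) hne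
      refine le_trans (ENNReal.ofReal_le_ofReal ?_) (hpt i₀ i hi x hx)
      refine Real.rpow_le_rpow (abs_nonneg _) ?_ hp.le
      have h6 : 𝓔.val v x - v' x = ∑ j ∈ N i₀, (a j - v' x) * 𝓔.val (ψ j) x := by
        rw [h2 i₀ hi₀ hx]
        simp_rw [sub_mul]
        rw [Finset.sum_sub_distrib, ← Finset.mul_sum, h5, mul_one]
      rw [h6]
      calc _ ≤ ∑ j ∈ N i₀, |(a j - v' x) * 𝓔.val (ψ j) x| := Finset.abs_sum_le_sum_abs _ _
        _ ≤ ∑ j ∈ N i₀, |v' x - a i| * 𝓔.val (ψ j) x := by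
            refine Finset.sum_le_sum fun j hj => ?_
            rw [abs_mul, abs_of_nonneg (h4 j (hNS j hj)), abs_sub_comm]
            exact mul_le_mul_of_nonneg_right (himax j hj) (h4 j (hNS j hj))
        _ = |v' x - a i| := by rw [← Finset.mul_sum, h5, mul_one]
    calc _ ≤ ∫⁻ x, c * W x ∂m := lintegral_mono_ae h1
      _ = c * ∫⁻ x, W x ∂m := lintegral_const_mul _ hWm
      _ ≤ _ := by
          gcongr
          exact le_max_right _ _

end PEnergyStructure

/-! ### Korevaar-Schoen energies -/

section KS

variable {X : Type*} [MetricSpace X] [MeasurableSpace X] [BorelSpace X]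
  {m : Measure X} {p : ℝ} {Ψ : ℝ → ℝ} {Ω : Set X} {u v : X → ℝ} {r : ℝ}

theorem ksEnergy_congr {X : Type*} [MetricSpace X] [MeasurableSpace X] {m : Measure X} {p : ℝ}
    {Ψ : ℝ → ℝ} {Ω : Set X} {u v : X → ℝ} (h : u =ᵐ[m.restrict Ω] v) :
    ksEnergy m p Ψ Ω u = ksEnergy m p Ψ Ω v := by
  funext r
  refine lintegral_congr_ae ?_
  filter_upwards [h] with y hy
  congr 1
  refine lintegral_congr_ae ?_
  filter_upwards [ae_restrict_of_ae_restrict_of_subset inter_subset_left h] with x hx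
  rw [hx, hy]

theorem ksEnergyDist_congr {X : Type*} [MetricSpace X] [MeasurableSpace X] {m : Measure X} {p : ℝ}
    {Ψ : ℝ → ℝ} {Ω : Set X} {u v : X → ℝ} (h : u =ᵐ[m.restrict Ω] v) :
    ksEnergyDist m p Ψ Ω u = ksEnergyDist m p Ψ Ω v := by
  funext r
  refine lintegral_congr_ae ?_
  filter_upwards [h] with y hy
  congr 1
  refine lintegral_congr_ae ?_
  filter_upwards [ae_restrict_of_ae_restrict_of_subset inter_subset_left h] with x hx
  rw [hx, hy]

theorem lintegral_ofReal_div {X : Type*} [MeasurableSpace X] {μ : Measure X} {a : ℝ} (ha : 0 < a)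
    (f : X → ℝ) : ∫⁻ x, ENNReal.ofReal (f x / a) ∂μ =
      (ENNReal.ofReal a)⁻¹ * ∫⁻ x, ENNReal.ofReal (f x) ∂μ := by
  rw [← lintegral_const_mul' _ _ (by simpa using ha)]
  refine lintegral_congr fun x => ?_
  rw [ENNReal.ofReal_div_of_pos ha, ENNReal.div_eq_inv_mul]

theorem ksEnergy_le {X : Type*} [MetricSpace X] [MeasurableSpace X] {m : Measure X} {p : ℝ}
    {Ψ : ℝ → ℝ} {Ω : Set X} {u : X → ℝ} {r : ℝ} (hr : 0 < Ψ r) : ksEnergy m p Ψ Ω u r ≤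
      (ENNReal.ofReal (Ψ r))⁻¹ * ∫⁻ y, meanOsc m p u r y ∂m := by
  rw [← lintegral_const_mul' _ _ (by simpa using hr)]
  refine (setLIntegral_le_lintegral _ _).trans (lintegral_mono fun y => ?_)
  rw [lintegral_ofReal_div hr, meanOsc, mul_left_comm]
  gcongr
  exact inter_subset_right

theorem le_ksEnergy {X : Type*} [MetricSpace X] [MeasurableSpace X] {m : Measure X} {p : ℝ}
    {Ψ : ℝ → ℝ} {Ω : Set X} {u : X → ℝ} {r : ℝ} (hr : 0 < Ψ r) {V : Set X} (hV : MeasurableSet V)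
    (hVΩ : ∀ y ∈ V, y ∈ Ω ∧ Metric.ball y r ⊆ Ω) :
    (ENNReal.ofReal (Ψ r))⁻¹ * ∫⁻ y in V, meanOsc m p u r y ∂m ≤ ksEnergy m p Ψ Ω u r := by
  rw [← lintegral_const_mul' _ _ (by simpa using hr)]
  refine le_trans (setLIntegral_mono' hV fun y hy => ?_)
    (lintegral_mono_set fun y hy => (hVΩ y hy).1)
  rw [lintegral_ofReal_div hr, meanOsc, mul_left_comm, inter_eq_self_of_subset_right (hVΩ y hy).2]

theorem ksEnergy_add_le [SecondCountableTopology X] [SigmaFinite m] (hp : 0 < p)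
    (hu : Measurable u) (hr : 0 < Ψ r) :
    ksEnergy m p Ψ Ω (u + v) r ≤ 2 ^ p * (ksEnergy m p Ψ Ω u r + ksEnergy m p Ψ Ω v r) := by
  have hm : Measurable fun y => (m (Metric.ball y r))⁻¹ * ∫⁻ x in Ω ∩ Metric.ball y r,
      ENNReal.ofReal (|u x - u y| ^ p / Ψ r) ∂m := by
    have h1 := measurable_lintegral_ball (m := m.restrict Ω)
      (f := fun y x => ENNReal.ofReal (|u x - u y| ^ p / Ψ r)) (by
        have h1 : Measurable fun z : X × X => u z.2 - u z.1 :=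
          (hu.comp measurable_snd).sub (hu.comp measurable_fst)
        exact ((h1.abs.pow_const p).div_const _).ennreal_ofReal) r
    simp only [Measure.restrict_restrict Metric.isOpen_ball.measurableSet] at h1
    simp only [inter_comm Ω]
    exact (measurable_measure_ball r).inv.mul h1
  have h2 : (2 : ℝ≥0∞) ^ p ≠ ∞ := ENNReal.rpow_ne_top_of_nonneg hp.le (by simp)
  rw [ksEnergy, ksEnergy, ksEnergy, ← lintegral_add_left hm, ← lintegral_const_mul' _ _ h2]
  refine lintegral_mono fun y => ?_
  have hmy : Measurable fun x => ENNReal.ofReal (|u x - u y| ^ p / Ψ r) := by fun_prop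
  rw [← mul_add, ← lintegral_add_left hmy, mul_left_comm, ← lintegral_const_mul' _ _ h2]
  refine mul_le_mul' le_rfl (lintegral_mono fun x => ?_)
  have h3 := ofReal_abs_sub_rpow_le hp.le (u x - u y) (-(v x - v y)) 0
  rw [sub_zero, sub_zero, abs_neg, sub_neg_eq_add] at h3
  simp only [ENNReal.ofReal_div_of_pos hr, ENNReal.div_eq_inv_mul]
  rw [← mul_add, mul_left_comm]
  gcongr
  convert! h3 using 4
  simp only [Pi.add_apply]
  ring

theorem ksEnergy_le_ksEnergyDist {X : Type*} [MetricSpace X] [MeasurableSpace X] [BorelSpace X]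
    {m : Measure X} {p : ℝ} {Ψ : ℝ → ℝ} {Ω : Set X} {u : X → ℝ} {r : ℝ} (hp : 0 < p)
    (hΨ : IsScaleFunction Ψ) (hΩ : MeasurableSet Ω) :
    ksEnergy m p Ψ Ω u r ≤ ksEnergyDist m p Ψ Ω u r := by
  refine lintegral_mono fun y => mul_le_mul' le_rfl ?_
  refine setLIntegral_mono' (hΩ.inter Metric.isOpen_ball.measurableSet) fun x hx => ?_
  refine ENNReal.ofReal_le_ofReal ?_
  obtain rfl | hxy := eq_or_ne x y
  · simp [hp.ne']
  have hd := dist_pos.2 hxy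
  gcongr
  · exact hΨ.pos hd
  · exact hΨ.le hd (Metric.mem_ball.1 hx.2).le

end KS

namespace PEnergyStructure

variable {X : Type*} [MetricSpace X] [MeasurableSpace X] [BorelSpace X]
  {m : Measure X} {p : ℝ} [Fact (1 < p)]

theorem exists_ksEnergy_le [IsLocallyFiniteMeasure m] [m.IsOpenPosMeasure]
    (𝓔 : PEnergyStructure X m p) {Ψ : ℝ → ℝ} (hΨ : IsScaleFunction Ψ)
    (hVD : VolumeDoubling m) (hPI : 𝓔.PoincareInequality Ψ) :
    ∃ C : ℝ≥0, ∀ (u : 𝓔.F) (Ω : Set X) (r : ℝ), 0 < r →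
      ∫⁻ y, meanOsc m p (𝓔.val u) r y ∂m ≤ C * ENNReal.ofReal (Ψ r) * 𝓔.Γ u univ ∧
      ksEnergy m p Ψ Ω (𝓔.val u) r ≤ C * 𝓔.Γ u univ := by
  obtain ⟨C, κ, hκ, hC⟩ := 𝓔.exists_lintegral_meanOsc_le hΨ hVD hPI
  refine ⟨C, fun u Ω r hr => ?_⟩
  have h1 : ∫⁻ y, meanOsc m p (𝓔.val u) r y ∂m ≤ C * ENNReal.ofReal (Ψ r) * 𝓔.Γ u univ := by
    rw [← setLIntegral_univ]
    refine (hC u r hr univ).trans ?_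
    gcongr
    exact subset_univ _
  refine ⟨h1, (ksEnergy_le (hΨ.pos hr)).trans ?_⟩
  calc _ ≤ (ENNReal.ofReal (Ψ r))⁻¹ * (C * ENNReal.ofReal (Ψ r) * 𝓔.Γ u univ) := by gcongr
    _ = (ENNReal.ofReal (Ψ r))⁻¹ * ENNReal.ofReal (Ψ r) * (C * 𝓔.Γ u univ) := by ring
    _ ≤ 1 * (C * 𝓔.Γ u univ) := by gcongr; exact ENNReal.inv_mul_le_one _
    _ = _ := one_mul _

/-! ### Lower bounds -/

/-- Discrete approximations along radii `ρ_n → 0` with small Korevaar-Schoen energy have energy on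
`A` bounded by a multiple of `L`. The upper bound keeps their total energies bounded and their `L^p`
errors of order `Ψ(ρ_n)`, so lower semicontinuity passes the bound to `u`. -/
theorem exists_Γ_le_of_frequently_of_bounded [Nontrivial X] [ProperSpace X]
    [SecondCountableTopology X] [IsLocallyFiniteMeasure m] [m.IsOpenPosMeasure]
    (𝓔 : PEnergyStructure X m p) {Ψ : ℝ → ℝ} (hΨ : IsScaleFunction Ψ)
    (hVD : VolumeDoubling m) (hPI : 𝓔.PoincareInequality Ψ) (hcap : 𝓔.CapacityUpper Ψ) :
    ∃ C : ℝ≥0, ∀ (u : 𝓔.F) (o : X) (R : ℝ), (∀ᵐ x ∂m, x ∉ Metric.ball o R → 𝓔.val u x = 0) →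
      ∀ (A Ω : Set X) (δ : ℝ), MeasurableSet A → 0 < δ → Metric.thickening δ A ⊆ Ω → ∀ L : ℝ≥0∞,
        (∃ᶠ r in 𝓝[>] 0, ksEnergy m p Ψ Ω (𝓔.val u) r ≤ L) → 𝓔.Γ u A ≤ C * L := by
  obtain ⟨C₁, k, r₀, hk, hr₀, happ⟩ := 𝓔.exists_approx hΨ hVD hcap
  obtain ⟨C₂, hC₂⟩ := 𝓔.exists_ksEnergy_le hΨ hVD hPI
  obtain ⟨C₃, hC₃⟩ := hΨ.exists_le_mul hk
  refine ⟨C₁ * C₃, fun u o R hu A Ω δ hA hδ hAΩ L hL => ?_⟩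
  have hk0 : 0 < k := by linarith
  -- Approximating at scale `ρ/k` makes the oscillation scale exactly `ρ`. The points involved are
  -- within `2ρ/k + ρ ≤ 3ρ < δ` of `A`, hence in `Ω`.
  have hev : ∀ᶠ ρ in 𝓝[>] (0 : ℝ), 0 < ρ ∧ ρ < k * r₀ ∧ ρ < δ / 3 := by
    have h1 : 0 < min (k * r₀) (δ / 3) := lt_min (by positivity) (by positivity)
    filter_upwards [Ioo_mem_nhdsGT h1] with ρ hρ
    exact ⟨hρ.1, hρ.2.trans_le (min_le_left _ _), hρ.2.trans_le (min_le_right _ _)⟩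
  obtain ⟨ρ, hρ, hρL⟩ := exists_seq_forall_of_frequently (hL.and_eventually hev)
  have hr : ∀ n, 0 < ρ n / k := fun n => div_pos (hρL n).2.1 hk0
  have hkr : ∀ n, k * (ρ n / k) = ρ n := fun n => mul_div_cancel₀ _ hk0.ne'
  have hrρ : ∀ n, ρ n / k ≤ ρ n := fun n => div_le_self (hρL n).2.1.le hk
  choose v hv1 hv2 using fun n => happ u o R hu (ρ n / k) (hr n) (by
    rw [div_lt_iff₀ hk0, mul_comm]; exact (hρL n).2.2.1)
  simp only [hkr] at hv1 hv2
  have hΨk : ∀ n, (ENNReal.ofReal (Ψ (ρ n / k)))⁻¹ ≤ C₃ * (ENNReal.ofReal (Ψ (ρ n)))⁻¹ := fun n => by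
    have h1 := hC₃ _ (hr n)
    rw [hkr] at h1
    exact ENNReal.inv_le_mul_inv_of_le_mul h1 (by simpa using hΨ.pos (hρL n).2.1)
      ENNReal.ofReal_ne_top
  have hA' : ∀ n, 𝓔.Γ (v n) A ≤ (C₁ * C₃ : ℝ≥0) * L := fun n => by
    calc _ ≤ C₁ * (C₃ * (ENNReal.ofReal (Ψ (ρ n)))⁻¹) *
          ∫⁻ y in Metric.thickening (2 * (ρ n / k)) A, meanOsc m p (𝓔.val u) (ρ n) y ∂m := by
          refine (hv1 n A).trans ?_
          gcongr
          exact hΨk n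
      _ = C₁ * C₃ * ((ENNReal.ofReal (Ψ (ρ n)))⁻¹ *
          ∫⁻ y in Metric.thickening (2 * (ρ n / k)) A, meanOsc m p (𝓔.val u) (ρ n) y ∂m) := by ring
      _ ≤ C₁ * C₃ * ksEnergy m p Ψ Ω (𝓔.val u) (ρ n) := by
          gcongr
          refine le_ksEnergy (hΨ.pos (hρL n).2.1) Metric.isOpen_thickening.measurableSet
            fun y hy => ?_
          obtain ⟨z, hz, hyz⟩ := Metric.mem_thickening_iff.1 hy
          have h1 := hrρ n
          have h2 := (hρL n).2.2.2
          refine ⟨hAΩ (Metric.mem_thickening_iff.2 ⟨z, hz, by linarith⟩), fun x hx =>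
            hAΩ (Metric.mem_thickening_iff.2 ⟨z, hz, ?_⟩)⟩
          rw [Metric.mem_ball] at hx
          linarith [dist_triangle x y z]
      _ ≤ _ := by
          push_cast
          gcongr
          exact (hρL n).1
  have huniv : ∀ n, 𝓔.Γ (v n) univ ≤ C₁ * C₃ * (C₂ * 𝓔.Γ u univ) := fun n => by
    have hpos := hΨ.pos (hρL n).2.1
    calc _ ≤ C₁ * (C₃ * (ENNReal.ofReal (Ψ (ρ n)))⁻¹) *
          (C₂ * ENNReal.ofReal (Ψ (ρ n)) * 𝓔.Γ u univ) := by
          refine (hv1 n univ).trans ?_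
          gcongr
          · exact hΨk n
          · exact (setLIntegral_le_lintegral _ _).trans (hC₂ u univ _ (hρL n).2.1).1
      _ = C₁ * C₃ * (C₂ * 𝓔.Γ u univ) *
          ((ENNReal.ofReal (Ψ (ρ n)))⁻¹ * ENNReal.ofReal (Ψ (ρ n))) := by ring
      _ ≤ C₁ * C₃ * (C₂ * 𝓔.Γ u univ) * 1 := by gcongr; exact ENNReal.inv_mul_le_one _
      _ = _ := mul_one _
  refine 𝓔.Γ_le_of_tendsto hA (b := C₁ * C₃ * (C₂ * 𝓔.Γ u univ)) ?_ huniv hA' ?_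
  · exact ENNReal.mul_ne_top (by simp [ENNReal.mul_ne_top])
      (ENNReal.mul_ne_top (by simp) (measure_ne_top _ _))
  · apply 𝓔.tendsto_Lp_of_lintegral
    have h1 : Tendsto (fun n => C₁ * (C₂ * ENNReal.ofReal (Ψ (ρ n)) * 𝓔.Γ u univ)) atTop (𝓝 0) := by
      have h2 : Tendsto (fun n => ENNReal.ofReal (Ψ (ρ n))) atTop (𝓝 0) := hΨ.tendsto_zero.comp hρ
      have h3 := ENNReal.Tendsto.const_mul (a := C₁ * C₂ * 𝓔.Γ u univ) h2
        (Or.inr (ENNReal.mul_ne_top (by simp [ENNReal.mul_ne_top]) (measure_ne_top _ _)))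
      rw [mul_zero] at h3
      refine h3.congr fun n => ?_
      ring
    refine tendsto_of_tendsto_of_tendsto_of_le_of_le tendsto_const_nhds h1 (fun _ => zero_le)
      fun n => (hv2 n).trans ?_
    exact mul_le_mul' le_rfl (hC₂ u univ _ (hρL n).2.1).1

/-- Compactly supported `f n` converge to `u` in energy. By quasi-subadditivity and the upper bound,
passing between `u` and `f n` costs a multiple of the energy of `u - f n`, both in the
Korevaar-Schoen energy and in `Γ`. -/
theorem exists_Γ_le_liminf [Nontrivial X] [ProperSpace X]
    [SecondCountableTopology X] [IsLocallyFiniteMeasure m] [m.IsOpenPosMeasure]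
    (𝓔 : PEnergyStructure X m p) {Ψ : ℝ → ℝ} (hΨ : IsScaleFunction Ψ)
    (hVD : VolumeDoubling m) (hPI : 𝓔.PoincareInequality Ψ) (hcap : 𝓔.CapacityUpper Ψ) :
    ∃ C : ℝ≥0, C ≠ 0 ∧ ∀ (u : 𝓔.F) (A Ω : Set X) (δ : ℝ), MeasurableSet A → 0 < δ →
      Metric.thickening δ A ⊆ Ω →
        𝓔.Γ u A ≤ C * liminf (ksEnergy m p Ψ Ω (𝓔.val u)) (𝓝[>] 0) := by
  have hp := exponent_pos p
  obtain ⟨C₁, hC₁⟩ := 𝓔.exists_Γ_le_of_frequently_of_bounded hΨ hVD hPI hcap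
  obtain ⟨C₂, hC₂⟩ := 𝓔.exists_ksEnergy_le hΨ hVD hPI
  -- The summand `1` keeps the constant nonzero, so that it can be divided out before choosing `L`
  -- strictly above the liminf.
  refine ⟨2 ^ p * (C₁ * 2 ^ p) + 1, by positivity, fun u A Ω δ hA hδ hAΩ => ?_⟩
  set K : ℝ≥0 := 2 ^ p * (C₁ * 2 ^ p) + 1 with hK
  have hK0 : (K : ℝ≥0∞) ≠ 0 := by simp [hK]
  rw [← ENNReal.div_le_iff' hK0 ENNReal.coe_ne_top]
  refine le_of_forall_gt_imp_ge_of_dense fun L hL => ?_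
  rw [ENNReal.div_le_iff' hK0 ENNReal.coe_ne_top]
  have hfreq := frequently_lt_of_liminf_lt (by isBoundedDefault) hL
  obtain ⟨f, g, hfg, -, hf, -⟩ := 𝓔.exists_seq_tendsto u
  obtain ⟨o⟩ : Nonempty X := inferInstance
  have hbound : ∀ n, 𝓔.Γ u A ≤
      2 ^ p * (C₁ * (2 ^ p * (L + C₂ * 𝓔.Γ (u - f n) univ)) + 𝓔.Γ (u - f n) univ) := fun n => by
    have hneg : ∀ B : Set X, MeasurableSet B → 𝓔.Γ (f n - u) B = 𝓔.Γ (u - f n) B :=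
      fun B hB => by rw [← neg_sub, 𝓔.Γ_neg hB]
    obtain ⟨R, hR⟩ := (g n).hasCompactSupport'.isCompact.isBounded.subset_ball o
    have hsupp : ∀ᵐ x ∂m, x ∉ Metric.ball o R → 𝓔.val (f n) x = 0 := by
      filter_upwards [hfg n] with x hx hxo
      rw [hx]
      exact image_eq_zero_of_notMem_tsupport fun h => hxo (hR h)
    have h1 : ∃ᶠ r in 𝓝[>] 0, ksEnergy m p Ψ Ω (𝓔.val (f n)) r ≤
        2 ^ p * (L + C₂ * 𝓔.Γ (u - f n) univ) := by
      refine (hfreq.and_eventually self_mem_nhdsWithin).mono fun r hr => ?_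
      have hr0 : 0 < r := hr.2
      have h2 : 𝓔.val (f n) =ᵐ[m.restrict Ω] 𝓔.val u + 𝓔.val (f n - u) := by
        refine ae_restrict_of_ae ?_
        have := 𝓔.val_add u (f n - u)
        rwa [add_sub_cancel] at this
      rw [ksEnergy_congr h2]
      refine (ksEnergy_add_le hp (𝓔.measurable_val u) (hΨ.pos hr0)).trans ?_
      gcongr
      · exact hr.1.le
      · rw [← hneg univ MeasurableSet.univ]
        exact (hC₂ (f n - u) Ω r hr0).2
    refine (𝓔.Γ_le_of_sub_le hA (f n) u).trans ?_
    refine mul_le_mul' le_rfl (add_le_add (hC₁ (f n) o R hsupp A Ω δ hA hδ hAΩ _ h1) ?_)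
    rw [hneg A hA]
    exact measure_mono (subset_univ _)
  have h2p := two_rpow_ne_top p
  have hlim : Tendsto (fun n => 2 ^ p * (C₁ * (2 ^ p * (L + C₂ * 𝓔.Γ (u - f n) univ)) +
      𝓔.Γ (u - f n) univ)) atTop (𝓝 (2 ^ p * (C₁ * (2 ^ p * (L + C₂ * 0)) + 0))) :=
    ENNReal.Tendsto.const_mul ((ENNReal.Tendsto.const_mul (ENNReal.Tendsto.const_mul
      (tendsto_const_nhds.add (ENNReal.Tendsto.const_mul hf (Or.inr ENNReal.coe_ne_top)))
      (Or.inr h2p)) (Or.inr ENNReal.coe_ne_top)).add hf) (Or.inr h2p)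
  calc _ ≤ 2 ^ p * (C₁ * (2 ^ p * (L + C₂ * 0)) + 0) := ge_of_tendsto' hlim hbound
    _ = 2 ^ p * (C₁ * 2 ^ p) * L := by ring
    _ ≤ K * L := by
        gcongr
        rw [hK]
        push_cast
        rw [ENNReal.coe_rpow_of_nonneg _ hp.le]
        exact le_self_add

/-! ### Energy measures of local functions -/

/-- Strong locality bounds every measure in the supremum by that of `w`. Conversely, `w` is itself a
competitor on a relatively compact neighbourhood of each compact subset, and these exhaust the mass
of `Ω`. -/
theorem localΓ_eq [SecondCountableTopology X] [LocallyCompactSpace X]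
    (𝓔 : PEnergyStructure X m p) {Ω : Set X} (hΩ : IsOpen Ω) {u : X → ℝ} {w : 𝓔.F}
    (hw : u =ᵐ[m.restrict Ω] 𝓔.val w) : 𝓔.localΓ Ω u Ω = 𝓔.Γ w Ω := by
  have hwA : ∀ A : Set X, IsRelCompactOpenIn A Ω → u =ᵐ[m.restrict A] 𝓔.val w := fun A hA =>
    ae_restrict_of_ae_restrict_of_subset (subset_closure.trans hA.2.2) hw
  refine le_antisymm ?_ ?_
  · have h : 𝓔.localΓ Ω u ≤ 𝓔.Γ w := by
      refine iSup_le fun A => iSup_le fun hA => iSup_le fun v => iSup_le fun hv => ?_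
      refine Measure.le_iff.2 fun s hs => ?_
      rw [Measure.restrict_apply hs]
      have h1 : ∀ᵐ x ∂m, x ∈ A → 𝓔.val v x - 𝓔.val w x = 0 := by
        rw [← ae_restrict_iff' hA.1.measurableSet]
        filter_upwards [hv, hwA A hA] with x h1 h2
        rw [← h1, h2, sub_self]
      rw [𝓔.Γ_eq_of_ae_sub_const hA.1 h1 (hs.inter hA.1.measurableSet) inter_subset_right]
      exact measure_mono inter_subset_left
    exact h Ω
  · rw [hΩ.measure_eq_iSup_isCompact]
    refine iSup_le fun K => iSup_le fun hKΩ => iSup_le fun hK => ?_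
    obtain ⟨A, hA, hKA, hAΩ, hAc⟩ := exists_open_between_and_isCompact_closure hK hΩ hKΩ
    have hrel : IsRelCompactOpenIn A Ω := ⟨hA, hAc, hAΩ⟩
    have h : (𝓔.Γ w).restrict A ≤ 𝓔.localΓ Ω u :=
      le_iSup_of_le A (le_iSup_of_le hrel (le_iSup_of_le w (le_iSup_of_le (hwA A hrel) le_rfl)))
    calc 𝓔.Γ w K ≤ (𝓔.Γ w).restrict A Ω := by
          rw [Measure.restrict_apply hΩ.measurableSet]
          exact measure_mono (subset_inter hKΩ hKA)
      _ ≤ 𝓔.localΓ Ω u Ω := h Ω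

end PEnergyStructure

/-! ### Upper bounds at small and large radii, and the theorem -/

theorem exists_le_dist {X : Type*} [MetricSpace X] {a b : X} {r : ℝ} (hr : r ≤ dist a b) (hr0 : 0 < r)
    (y : X) : ∃ z, r / 8 ≤ dist y z := by
  by_contra! h
  linarith [h a, h b, dist_triangle_left a b y]

theorem ofReal_inv_mul_le {C : ℝ} {c : ℝ≥0} (hC : 0 < C) (hc : (c : ℝ) ≤ C) {x y : ℝ≥0∞}
    (h : x ≤ c * y) : ENNReal.ofReal C⁻¹ * x ≤ y := by
  have h1 : (c : ℝ≥0∞) ≤ ENNReal.ofReal C := by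
    rw [← ENNReal.ofReal_coe_nnreal]
    exact ENNReal.ofReal_le_ofReal hc
  calc _ ≤ ENNReal.ofReal C⁻¹ * (ENNReal.ofReal C * y) := by
        refine mul_le_mul' le_rfl (h.trans ?_)
        gcongr
    _ = y := by
        rw [← mul_assoc, ← ENNReal.ofReal_mul (by positivity), inv_mul_cancel₀ hC.ne',
          ENNReal.ofReal_one, one_mul]

namespace PEnergyStructure

variable {X : Type*} [MetricSpace X] [MeasurableSpace X] [BorelSpace X]
  {m : Measure X} {p : ℝ} [Fact (1 < p)]

/-- Korevaar-Schoen bounds on a proper space with a locally finite measure of full support. -/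
theorem exists_ksEnergyDist_le [Nontrivial X] [SecondCountableTopology X] [ProperSpace X]
    [IsLocallyFiniteMeasure m] [m.IsOpenPosMeasure]
    (𝓔 : PEnergyStructure X m p) {Ψ : ℝ → ℝ} (hΨ : IsScaleFunction Ψ)
    (hVD : VolumeDoubling m) (hPI : 𝓔.PoincareInequality Ψ) :
    ∃ (C : ℝ≥0), ∀ w : 𝓔.F, (∀ Ω : Set X, 𝓔.Γ w (frontier Ω) = 0 →
        limsup (ksEnergyDist m p Ψ Ω (𝓔.val w)) (𝓝[>] 0) ≤ C * 𝓔.Γ w Ω) ∧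
      ∀ r : ℝ, 0 < r → ksEnergyDist m p Ψ univ (𝓔.val w) r ≤ C * 𝓔.Γ w univ := by
  obtain ⟨C, κ, hκ, hC⟩ := 𝓔.exists_lintegral_dist_le hΨ hVD hPI
  obtain ⟨a, b, hab⟩ := exists_pair_ne X
  have hd : 0 < dist a b := dist_pos.2 hab
  have hle : ∀ (w : 𝓔.F) (Ω : Set X) (r : ℝ), 0 < r → (∀ y : X, ∃ z, r / 8 ≤ dist y z) →
      ksEnergyDist m p Ψ Ω (𝓔.val w) r ≤ C * 𝓔.Γ w (Metric.thickening (κ * r) Ω) :=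
    fun w Ω r hr hz => le_trans (lintegral_mono fun y => mul_le_mul' le_rfl
      (lintegral_mono_set inter_subset_right)) (hC w r hr hz Ω)
  refine ⟨C, fun w => ⟨fun Ω hΩ => ?_, fun r hr => ?_⟩⟩
  · have h1 : Tendsto (fun r => κ * r) (𝓝[>] (0 : ℝ)) (𝓝[>] 0) := by
      refine tendsto_nhdsWithin_iff.2 ⟨?_, ?_⟩
      · have : Tendsto (fun r => κ * r) (𝓝 (0 : ℝ)) (𝓝 (κ * 0)) := tendsto_id.const_mul κ
        rw [mul_zero] at this
        exact this.mono_left nhdsWithin_le_nhds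
      · filter_upwards [self_mem_nhdsWithin] with r hr
        exact mul_pos hκ hr
    -- Thickenings shrink to the closure of `Ω`, whose energy is that of `Ω` because the boundary
    -- carries none.
    have h2 := ENNReal.Tendsto.const_mul (a := (C : ℝ≥0∞))
      ((tendsto_measure_thickening (μ := 𝓔.Γ w) (s := Ω) ⟨1, one_pos, measure_ne_top _ _⟩).comp h1)
      (Or.inr ENNReal.coe_ne_top)
    calc _ ≤ limsup (fun r => C * 𝓔.Γ w (Metric.thickening (κ * r) Ω)) (𝓝[>] 0) := by
          refine limsup_le_limsup ?_
          filter_upwards [Ioo_mem_nhdsGT hd] with r hr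
          exact hle w Ω r hr.1 (exists_le_dist hr.2.le hr.1)
      _ = C * 𝓔.Γ w (closure Ω) := h2.limsup_eq
      _ ≤ C * 𝓔.Γ w Ω := by
          refine mul_le_mul' le_rfl ?_
          rw [closure_eq_self_union_frontier]
          exact (measure_union_le _ _).trans (by rw [hΩ, add_zero])
  · have huniv : ∀ r, 𝓔.Γ w (Metric.thickening (κ * r) univ) ≤ 𝓔.Γ w univ := fun r =>
      measure_mono (subset_univ _)
    by_cases hz : ∀ y : X, ∃ z, r / 8 ≤ dist y z
    · exact (hle w univ r hr hz).trans (mul_le_mul' le_rfl (huniv r))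
    -- Here the whole space lies within `r/8` of `y₀`, so all balls of radius `r` are `X`, as are
    -- those of radius `2d` with `d` the diameter. At radius `2d` the previous case applies: points
    -- all within `d/4` of some `y` would force the diameter to be at most `d/2`.
    · push Not at hz
      obtain ⟨y₀, hy₀⟩ := hz
      have hbdd : Bornology.IsBounded (univ : Set X) :=
        (Metric.isBounded_ball (x := y₀) (r := r / 8)).subset fun z _ => by
          rw [Metric.mem_ball, dist_comm]; exact hy₀ z
      set d := Metric.diam (univ : Set X) with hd'
      have hdiam : ∀ x y : X, dist x y ≤ d := fun x y =>
        Metric.dist_le_diam_of_mem hbdd (mem_univ x) (mem_univ y)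
      have hd0 : 0 < d := hd.trans_le (hdiam a b)
      have hball : ∀ y : X, Metric.ball y r = Metric.ball y (2 * d) := fun y => by
        ext z
        simp only [Metric.mem_ball]
        refine iff_of_true ?_ ?_
        · linarith [dist_triangle_left z y y₀, hy₀ z, hy₀ y]
        · linarith [hdiam z y]
      have heq : ksEnergyDist m p Ψ univ (𝓔.val w) r =
          ksEnergyDist m p Ψ univ (𝓔.val w) (2 * d) := by
        simp only [ksEnergyDist, hball]
      rw [heq]
      refine (hle w univ (2 * d) (by positivity) fun y => ?_).trans (mul_le_mul' le_rfl (huniv _))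
      by_contra! h
      have h3 : d ≤ d / 2 := Metric.diam_le_of_forall_dist_le (by positivity) fun x _ z _ => by
        linarith [dist_triangle_left x z y, h x, h z]
      linarith

end PEnergyStructure

end

theorem mainTheorem3 {X : Type*} [MetricSpace X] [LocallyCompactSpace X]
    [TopologicalSpace.SeparableSpace X] [CompleteSpace X] [Nontrivial X]
    [MeasurableSpace X] [BorelSpace X]
    (m : Measure X) [m.Regular] [m.IsOpenPosMeasure]
    (p : ℝ) [Fact (1 < p)] (𝓔 : PEnergyStructure X m p)
    (Ψ : ℝ → ℝ) (hΨ : IsScaleFunction Ψ)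
    (hVD : VolumeDoubling m) (hPI : 𝓔.PoincareInequality Ψ) (hcap : 𝓔.CapacityUpper Ψ) :
    ∃ C : ℝ, 1 ≤ C ∧
      (∀ Ω : Set X, 𝓔.ExtensionProperty Ω → ∀ u : X → ℝ, 𝓔.MemOn Ω u →
        ENNReal.ofReal C⁻¹ * 𝓔.localΓ Ω u Ω ≤ liminf (ksEnergy m p Ψ Ω u) (𝓝[>] 0) ∧
        liminf (ksEnergy m p Ψ Ω u) (𝓝[>] 0) ≤ limsup (ksEnergyDist m p Ψ Ω u) (𝓝[>] 0) ∧
        limsup (ksEnergyDist m p Ψ Ω u) (𝓝[>] 0) ≤ ENNReal.ofReal C * 𝓔.localΓ Ω u Ω) ∧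
      (∀ u : 𝓔.F,
        ENNReal.ofReal (C⁻¹ * 𝓔.E u) ≤
          liminf (ksEnergy m p Ψ univ (𝓔.val u)) (𝓝[>] 0) ∧
        liminf (ksEnergy m p Ψ univ (𝓔.val u)) (𝓝[>] 0) ≤
          ⨆ (r : ℝ) (_ : 0 < r), ksEnergyDist m p Ψ univ (𝓔.val u) r ∧
        (⨆ (r : ℝ) (_ : 0 < r), ksEnergyDist m p Ψ univ (𝓔.val u) r) ≤
          ENNReal.ofReal (C * 𝓔.E u)) := by
  have hp := PEnergyStructure.exponent_pos p
  have : SecondCountableTopology X := UniformSpace.secondCountable_of_separable X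
  have : ProperSpace X := hVD.properSpace
  obtain ⟨C₁, hC₁⟩ := 𝓔.exists_ksEnergyDist_le hΨ hVD hPI
  obtain ⟨C₂, -, hC₂⟩ := 𝓔.exists_Γ_le_liminf hΨ hVD hPI hcap
  set C : ℝ := max 1 (max C₁ C₂) with hC
  have hC1 : 1 ≤ C := le_max_left _ _
  have hC0 : 0 < C := by linarith
  have hCC₂ : (C₂ : ℝ) ≤ C := (le_max_right _ _).trans (le_max_right _ _)
  have hCC₁ : (C₁ : ℝ≥0∞) ≤ ENNReal.ofReal C := by
    rw [← ENNReal.ofReal_coe_nnreal]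
    exact ENNReal.ofReal_le_ofReal ((le_max_left _ _).trans (le_max_right _ _))
  have hmid : ∀ (Ω : Set X) (u : X → ℝ), MeasurableSet Ω →
      liminf (ksEnergy m p Ψ Ω u) (𝓝[>] 0) ≤ limsup (ksEnergyDist m p Ψ Ω u) (𝓝[>] 0) :=
    fun Ω u hΩ => (liminf_le_liminf (Eventually.of_forall fun r =>
      ksEnergy_le_ksEnergyDist hp hΨ hΩ)).trans liminf_le_limsup
  refine ⟨C, hC1, fun Ω hΩ u hu => ?_, fun u => ⟨?_, ?_, ?_⟩⟩
  · obtain ⟨hΩo, -, hext⟩ := hΩ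
    obtain ⟨w, hw, hw0⟩ := hext u hu
    rw [𝓔.localΓ_eq hΩo hw, ksEnergy_congr hw, ksEnergyDist_congr hw]
    refine ⟨ofReal_inv_mul_le hC0 hCC₂ ?_, hmid Ω _ hΩo.measurableSet, ?_⟩
    -- Each compact subset has a thickening inside `Ω`, and the constant of the lower bound does not
    -- depend on its width.
    · rw [hΩo.measure_eq_iSup_isCompact]
      refine iSup_le fun K => iSup_le fun hKΩ => iSup_le fun hK => ?_
      obtain ⟨δ, hδ, hKδ⟩ := hK.exists_thickening_subset_open hΩo hKΩ
      exact hC₂ w K Ω δ hK.measurableSet hδ hKδ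
    · exact ((hC₁ w).1 Ω hw0).trans (by gcongr)
  · rw [ENNReal.ofReal_mul (by positivity), 𝓔.ofReal_E]
    exact ofReal_inv_mul_le hC0 hCC₂
      (hC₂ u univ univ 1 MeasurableSet.univ one_pos (subset_univ _))
  · refine (hmid univ _ MeasurableSet.univ).trans (limsup_le_of_le (by isBoundedDefault) ?_)
    filter_upwards [self_mem_nhdsWithin] with r hr
    exact le_iSup₂_of_le r hr le_rfl
  · rw [ENNReal.ofReal_mul hC0.le, 𝓔.ofReal_E]
    exact iSup₂_le fun r hr => ((hC₁ u).2 r hr).trans (by gcongr)
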